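/- Let $N\ge 0$ be an integer and let $\mathcal H=(\mathbb C^2)^{\otimes N}$ be the state space of $N$ spin-$\tfrac12$ particles. Let $SU(2)$ act on $\mathcal H$ by $U\mapsto U^{\otimes N}$, and let the symmetric group $S_N$ act by $$P_\sigma(s_1\otimes\cdots\otimes s_N)=s_{\sigma^{-1}(1)}\otimes\cdots\otimes s_{\sigma^{-1}(N)} .$$ For $J\in\{\tfrac N2,\tfrac N2-1,\dots\}$ with $J\ge 0$ let $V_J=\mathrm{Sym}^{2J}(\mathbb C^2)$ be the spin-$J$ irreducible representation of $SU(2)$, of dimension $2J+1$, and let $W_{\lambda(J)}$ be the irreducible complex representation (Specht module) of $S_N$ labelled by the Young diagram $\lambda(J)=(\tfrac N2+J,\tfrac N2-J)$. Then there is an isomorphism of representations of $SU(2)\times S_N$ (a Schur–Weyl decomposition) $$\Phi:\ \mathcal H\ \xrightarrow{\ \cong\ }\ \bigoplus_J V_J\otimes W_{\lambda(J)} .$$ Moreover, for every such isomorphism $\Phi$ and every linear operator $H$ on $\mathcal H$ with $HP_\sigma=P_\sigma H$ for all $\sigma\in S_N$, there are linear operators $H_J$ on $V_J$ such that $$\Phi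 H\Phi^{-1}=\bigoplus_J H_J\otimes I_{W_{\lambda(J)}} .$$ In particular, for $N=6$, $\mathcal H\cong V_3\otimes W_{(6)}\oplus V_2\otimes W_{(5,1)}\oplus V_1\otimes W_{(4,2)}\oplus V_0\otimes W_{(3,3)}$, and in this decomposition $H=H_3\otimes I_{(6)}\oplus H_2\otimes I_{(5,1)}\oplus H_1\otimes I_{(4,2)}\oplus H_0\otimes I_{(3,3)}$. -/

import Mathlib

open scoped TensorProduct DirectSum

noncomputable section

namespace SchurWeyl

/-- The group `SU(2)` of unitary `2 × 2` complex matrices of determinant one. -/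
abbrev SU2 : Type := Matrix.specialUnitaryGroup (Fin 2) ℂ

/-- The Hilbert space `(ℂ²)^{⊗ N}` of `N` spin-1/2 particles (as a complex vector space). -/
abbrev SpinSpace (N : ℕ) : Type := ⨂[ℂ] _ : Fin N, (Fin 2 → ℂ)

/-- The operator `P_σ`, which sends `s₁ ⊗ ⋯ ⊗ s_N` to `s_{σ⁻¹(1)} ⊗ ⋯ ⊗ s_{σ⁻¹(N)}`. -/
def sitePerm {N : ℕ} (σ : Equiv.Perm (Fin N)) : Module.End ℂ (SpinSpace N) :=
  (PiTensorProduct.reindex ℂ (fun _ : Fin N => (Fin 2 → ℂ)) σ).toLinearMap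

theorem sitePerm_tprod {N : ℕ} (σ : Equiv.Perm (Fin N)) (s : Fin N → (Fin 2 → ℂ)) :
    sitePerm σ (PiTensorProduct.tprod ℂ s) = PiTensorProduct.tprod ℂ fun i => s (σ⁻¹ i) :=
  PiTensorProduct.reindex_tprod σ s

/-- The collective rotation `U^{⊗ N}`. -/
def collective {N : ℕ} (U : SU2) : Module.End ℂ (SpinSpace N) :=
  PiTensorProduct.map fun _ : Fin N => Matrix.toLin' (U : Matrix (Fin 2) (Fin 2) ℂ)

theorem collective_tprod {N : ℕ} (U : SU2) (s : Fin N → (Fin 2 → ℂ)) :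
    collective U (PiTensorProduct.tprod ℂ s) = PiTensorProduct.tprod ℂ fun i =>
      (U : Matrix (Fin 2) (Fin 2) ℂ).mulVec (s i) := by
  simp [collective]

/-- The joint action of `SU(2) × S_N` on `(ℂ²)^{⊗ N}`: `(U, σ)` acts as `U^{⊗ N} P_σ`. -/
def spinSpaceRep (N : ℕ) : Representation ℂ (SU2 × Equiv.Perm (Fin N)) (SpinSpace N) where
  toFun g := collective g.1 ∘ₗ sitePerm g.2
  map_one' := by
    refine PiTensorProduct.ext (MultilinearMap.ext fun s => ?_)
    simp [sitePerm_tprod, collective_tprod]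
  map_mul' g h := by
    refine PiTensorProduct.ext (MultilinearMap.ext fun s => ?_)
    simp only [LinearMap.compMultilinearMap_apply, LinearMap.comp_apply, Module.End.mul_apply,
      sitePerm_tprod, collective_tprod, Matrix.mulVec_mulVec, Prod.fst_mul, Prod.snd_mul,
      Submonoid.coe_mul, mul_inv_rev, Equiv.Perm.mul_apply]

/-- The linear substitution `X_j ↦ ∑ i, U i j • X_i` on complex polynomials in two variables,
the algebra map extending the standard action of `U` on `ℂ² = span (X_0, X_1)`. -/
def polySubst (U : SU2) : MvPolynomial (Fin 2) ℂ →ₐ[ℂ] MvPolynomial (Fin 2) ℂ :=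
  MvPolynomial.aeval fun j => ∑ i, (U : Matrix (Fin 2) (Fin 2) ℂ) i j • MvPolynomial.X i

/-- The action of `SU(2)` on complex polynomials in two variables. -/
def polyRep : Representation ℂ SU2 (MvPolynomial (Fin 2) ℂ) where
  toFun U := (polySubst U).toLinearMap
  map_one' := by
    have h : polySubst 1 = AlgHom.id ℂ _ := by
      refine MvPolynomial.algHom_ext fun j => ?_
      simp [polySubst, Matrix.one_apply, ite_smul]
    rw [h]
    rfl
  map_mul' U V := by
    have h : polySubst (U * V) = (polySubst U).comp (polySubst V) := by
      refine MvPolynomial.algHom_ext fun j => ?_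
      simp only [polySubst, AlgHom.comp_apply, MvPolynomial.aeval_X, map_sum, map_smul,
        Submonoid.coe_mul, Matrix.mul_apply, Finset.sum_smul, Finset.smul_sum, smul_smul]
      rw [Finset.sum_comm]
      simp only [mul_comm]
    rw [h]
    rfl

/-- The binary forms of degree `n`, as a subrepresentation. -/
def spinSub (n : ℕ) : Subrepresentation polyRep where
  toSubmodule := MvPolynomial.homogeneousSubmodule (Fin 2) ℂ n
  apply_mem_toSubmodule U p hp := by
    rw [MvPolynomial.mem_homogeneousSubmodule] at hp ⊢
    have h := hp.aeval (fun j : Fin 2 => ∑ i, (U : Matrix (Fin 2) (Fin 2) ℂ) i j •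
      (MvPolynomial.X i : MvPolynomial (Fin 2) ℂ)) (n := 1) (fun j => by
        refine MvPolynomial.IsHomogeneous.sum _ _ _ fun i _ => ?_
        rw [MvPolynomial.smul_eq_C_mul]
        simpa using (MvPolynomial.isHomogeneous_C (Fin 2) _).mul
          (MvPolynomial.isHomogeneous_X ℂ i))
    rw [one_mul] at h
    exact h

/-- The space `V_J` of the spin-`J` irreducible representation of `SU(2)`, with `n = 2 J`:
the binary forms of degree `n`, i.e. `Symⁿ(ℂ²)`, of dimension `n + 1 = 2 J + 1`. -/
abbrev SpinIrrep (n : ℕ) : Type := (spinSub n).toSubmodule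

/-- The action of `SU(2)` on `V_J`, with `n = 2 J`. -/
def spinRep (n : ℕ) : Representation ℂ SU2 (SpinIrrep n) := (spinSub n).toRepresentation

/-- The permutation representation of `S_N` on formal combinations of row assignments
`r : {1, …, N} → ℕ`. A tabloid is identified with the function that sends each entry
to the index of its row. -/
def tabloidRep (N : ℕ) : Representation ℂ (Equiv.Perm (Fin N)) ((Fin N → ℕ) →₀ ℂ) where
  toFun σ := Finsupp.lmapDomain ℂ ℂ fun r => r ∘ ⇑σ⁻¹
  map_one' := by
    ext r : 2
    simp [Finsupp.mapDomain_single]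
  map_mul' σ τ := by
    ext r : 2
    simp [Finsupp.mapDomain_single, Function.comp_assoc]

/-- A Young tableau of shape `μ` with entries `1, …, N`, each used once: `T i` is the cell
(row, column) that contains the entry `i`. -/
abbrev Tableau (μ : YoungDiagram) (N : ℕ) : Type := Fin N ≃ {c : ℕ × ℕ // c ∈ μ.cells}

/-- The polytabloid `e_T = ∑ sgn(π) {π T}`, over the `π` that preserve each column of `T`. -/
def polytabloid {μ : YoungDiagram} {N : ℕ} (T : Tableau μ N) : (Fin N → ℕ) →₀ ℂ :=
  ∑ π : Equiv.Perm (Fin N) with ∀ i, (T (π i)).1.2 = (T i).1.2,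
    ((Equiv.Perm.sign π : ℤ) : ℂ) • Finsupp.single (fun i => (T (π⁻¹ i)).1.1) 1

/-- `σ e_T = e_{σ T}`, where `σ T` has the entry `σ i` where `T` has the entry `i`. -/
theorem tabloidRep_polytabloid {μ : YoungDiagram} {N : ℕ} (σ : Equiv.Perm (Fin N))
    (T : Tableau μ N) :
    tabloidRep N σ (polytabloid T) = polytabloid (σ.symm.trans T : Tableau μ N) := by
  simp only [polytabloid, map_sum, map_smul]
  refine Finset.sum_bij (fun π _ => σ * π * σ⁻¹) ?_ ?_ ?_ ?_
  · intro π hπ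
    simp only [Finset.mem_filter, Finset.mem_univ, true_and] at hπ ⊢
    intro i
    simp only [Equiv.trans_apply, Equiv.Perm.mul_apply, Equiv.symm_apply_apply]
    exact hπ (σ⁻¹ i)
  · intro π _ π' _ h
    simpa using h
  · intro π hπ
    refine ⟨σ⁻¹ * π * σ, ?_, by group⟩
    simp only [Finset.mem_filter, Finset.mem_univ, true_and] at hπ ⊢
    intro i
    have h := hπ (σ i)
    simp only [Equiv.trans_apply, Equiv.symm_apply_apply] at h
    exact h
  · intro π _
    have h : Equiv.Perm.sign (σ * π * σ⁻¹) = Equiv.Perm.sign π := by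
      rw [map_mul, map_mul, map_inv, mul_right_comm, mul_inv_cancel, one_mul]
    rw [h]
    congr 1
    simp [tabloidRep, Finsupp.mapDomain_single, mul_inv_rev]
    rfl

/-- The span of the polytabloids of shape `μ`, as a subrepresentation. -/
def spechtSub (N : ℕ) (μ : YoungDiagram) : Subrepresentation (tabloidRep N) where
  toSubmodule := Submodule.span ℂ (Set.range fun T : Tableau μ N => polytabloid T)
  apply_mem_toSubmodule σ v hv := by
    induction hv using Submodule.span_induction with
    | mem x hx =>
      obtain ⟨T, rfl⟩ := hx
      change tabloidRep N σ (polytabloid T) ∈ _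
      rw [tabloidRep_polytabloid]
      exact Submodule.subset_span ⟨_, rfl⟩
    | zero => simp
    | add x y _ _ hx hy => rw [map_add]; exact add_mem hx hy
    | smul a x _ hx => rw [map_smul]; exact Submodule.smul_mem _ a hx

/-- The Specht module `W_μ` over `ℂ`: for `μ` with `N` cells, the irreducible representation of
`S_N` labelled by the Young diagram `μ`. -/
abbrev Specht (N : ℕ) (μ : YoungDiagram) : Type := (spechtSub N μ).toSubmodule

/-- The action of `S_N` on the Specht module. -/
def spechtRep (N : ℕ) (μ : YoungDiagram) :
    Representation ℂ (Equiv.Perm (Fin N)) (Specht N μ) := (spechtSub N μ).toRepresentation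

/-- The possible total spins of `N` particles are `J = N/2 - k` with `k = 0, …, ⌊N/2⌋`. -/
abbrev SpinIndex (N : ℕ) : Type := Fin (N / 2 + 1)

/-- Twice the total spin, `2 J = N - 2 k`. -/
def twiceSpin {N : ℕ} (k : SpinIndex N) : ℕ := N - 2 * k

/-- The Young diagram `λ(J) = (N/2 + J, N/2 - J) = (N - k, k)`. -/
def shape {N : ℕ} (k : SpinIndex N) : YoungDiagram :=
  YoungDiagram.ofRowLens [N - k, k] (by
    have := k.2
    simp only [List.sortedGE_iff_pairwise, List.pairwise_cons, List.mem_singleton, forall_eq,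
      List.not_mem_nil, false_imp_iff, implies_true, List.Pairwise.nil, and_true]
    omega)

/-- The sector `V_J ⊗ W_{λ(J)}`. -/
abbrev Sector (N : ℕ) (k : SpinIndex N) : Type :=
  SpinIrrep (twiceSpin k) ⊗[ℂ] Specht N (shape k)

/-- The action of `SU(2) × S_N` on `V_J ⊗ W_{λ(J)}`: `SU(2)` acts on the first factor and `S_N`
on the second. -/
def sectorRep (N : ℕ) (k : SpinIndex N) :
    Representation ℂ (SU2 × Equiv.Perm (Fin N)) (Sector N k) :=
  Representation.tprod
    ((spinRep (twiceSpin k)).comp (MonoidHom.fst SU2 (Equiv.Perm (Fin N))))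
    ((spechtRep N (shape k)).comp (MonoidHom.snd SU2 (Equiv.Perm (Fin N))))

/-- A Schur-Weyl decomposition of `(ℂ²)^{⊗ N}`: a linear isomorphism onto
`⨁ J, V_J ⊗ W_{λ(J)}` that respects the action of `SU(2) × S_N`. -/
abbrev Decomposition (N : ℕ) : Type :=
  (spinSpaceRep N).Equiv (Representation.directSum (sectorRep N))

/-- The block-diagonal operator `⨁ J, H_J ⊗ I` on `⨁ J, V_J ⊗ W_{λ(J)}`. -/
def blockDiagonal {N : ℕ} (A : ∀ k : SpinIndex N, Module.End ℂ (SpinIrrep (twiceSpin k))) :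
    Module.End ℂ (⨁ k, Sector N k) :=
  DirectSum.lmap fun k => TensorProduct.map (A k) (LinearMap.id : Module.End ℂ (Specht N (shape k)))

end SchurWeyl

end

noncomputable section

namespace SchurWeyl

variable {N : ℕ}

/-! The whole argument rests on one operator, the signed sum `colAntisymm` over the column group of
a fixed tableau of shape (N-k, k), where k = N/2 - J. It kills the Specht module of (N-l, l) for l <
k (`colAntisymm_specht_of_lt`), and on that of (N-k, k) its range is the line of the standard
polytabloid e (`colAntisymm_specht`). Together with cyclicity and positivity of the tabloid form,
this gives Schur's lemma directly: `specht_hom_eq_zero` and `specht_hom_eq_smul`. Irreducibility is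
never invoked.

For the commutant, the S_N-maps from W to V ⊗ W' are read coordinatewise in a basis of V. Schur's
lemma makes the off-diagonal blocks vanish and forces each diagonal block to be H_J ⊗ I.

For existence, `toForm` puts singlet determinants on the columns of length two and multiplies the
linear forms of the other sites. It is SU(2)-equivariant and transforms by the sign under the column
group. Summing over S_N against the translates of e yields the equivariant map `toSector`. In the
other direction `raise` embeds a Specht module into each weight space; `toSector` sends such a copy
to b • (monomial ⊗ w) with b ≠ 0 (`exists_toSector_raiseSpecht`), so the assembled map has a right
inverse.

That the copies fill the spin space is proved without counting dimensions (`functional_eq_zero`): a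
functional that vanishes on all of them and is antisymmetric in k columns of length two is zero, by
descending induction on k. Differences under a swap of two remaining sites are antisymmetric in one
more column, hence zero. So the functional is symmetric in the remaining sites, and its values on
raised polytabloids then determine it. -/

/-! ### A tableau with columns `{2j, 2j+1}` -/

/-- The row of the entry `i` in the tableau with columns `{2j, 2j+1}` for `j < k`. -/
def rowOf (k i : ℕ) : ℕ := if i < 2 * k then i % 2 else 0

/-- The column of the entry `i` in the tableau with columns `{2j, 2j+1}` for `j < k`. -/
def colOf (k i : ℕ) : ℕ := if i < 2 * k then i / 2 else i - k

theorem mem_shape (k : SpinIndex N) (c : ℕ × ℕ) :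
    c ∈ (shape k).cells ↔ (c.1 = 0 ∧ c.2 < N - k) ∨ (c.1 = 1 ∧ c.2 < k) := by
  obtain ⟨r, c⟩ := c
  rw [YoungDiagram.mem_cells, shape, YoungDiagram.mem_ofRowLens]
  rcases r with _ | _ | r <;> simp

theorem two_mul_le (k : SpinIndex N) : 2 * (k : ℕ) ≤ N := by
  have := k.2
  omega

/-- The tableau of shape `(N - k, k)` with columns `{2j, 2j+1}` for `j < k`. -/
def stdTableau (k : SpinIndex N) : Tableau (shape k) N where
  toFun i := ⟨(rowOf k i, colOf k i), by
    rw [mem_shape]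
    have := two_mul_le k
    have := i.2
    simp only [rowOf, colOf]
    split_ifs <;> omega⟩
  -- A column of length one, with index at least k, holds the entry obtained by adding k, since the
  -- first k columns use up 2k entries.
  invFun c := ⟨if c.1.2 < k then 2 * c.1.2 + c.1.1 else c.1.2 + k, by
    have := (mem_shape k c.1).1 c.2
    have := two_mul_le k
    split_ifs <;> omega⟩
  left_inv i := by
    have := two_mul_le k
    have := i.2
    ext
    simp only [rowOf, colOf]
    split_ifs <;> omega
  right_inv c := by
    have := (mem_shape k c.1).1 c.2
    have := two_mul_le k
    ext <;> simp only [rowOf, colOf] <;> split_ifs <;> omega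

/-- The column group of the tableau `stdTableau k`. -/
def colPerms (k : SpinIndex N) : Finset (Equiv.Perm (Fin N)) :=
  {π | ∀ i, (stdTableau k (π i)).1.2 = (stdTableau k i).1.2}

theorem mem_colPerms {k : SpinIndex N} {π : Equiv.Perm (Fin N)} :
    π ∈ colPerms k ↔ ∀ i, colOf k (π i) = colOf k i := by
  rw [colPerms, Finset.mem_filter]
  simp [stdTableau]

theorem one_mem_colPerms (k : SpinIndex N) : 1 ∈ colPerms k := by simp [mem_colPerms]

theorem mul_mem_colPerms {k : SpinIndex N} {π τ : Equiv.Perm (Fin N)} (hπ : π ∈ colPerms k)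
    (hτ : τ ∈ colPerms k) : π * τ ∈ colPerms k := by
  rw [mem_colPerms] at *
  intro i
  rw [Equiv.Perm.mul_apply, hπ, hτ]

theorem inv_mem_colPerms {k : SpinIndex N} {π : Equiv.Perm (Fin N)} (hπ : π ∈ colPerms k) :
    π⁻¹ ∈ colPerms k := by
  rw [mem_colPerms] at *
  intro i
  rw [← hπ (π⁻¹ i), ← Equiv.Perm.mul_apply, mul_inv_cancel, Equiv.Perm.one_apply]

theorem swap_mem_colPerms {k : SpinIndex N} {i j : Fin N} (h : colOf k i = colOf k j) :
    Equiv.swap i j ∈ colPerms k := by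
  rw [mem_colPerms]
  intro l
  rw [Equiv.swap_apply_def]
  split_ifs with h1 h2
  · rw [h1, h]
  · rw [h2, h]
  · rfl

theorem colPerms_card_ne_zero (k : SpinIndex N) : ((colPerms k).card : ℂ) ≠ 0 :=
  Nat.cast_ne_zero.2 (Finset.card_ne_zero_of_mem (one_mem_colPerms k))

/-- The other entry in the column of `i`, or `i` itself if the column has only one entry. -/
def partner (k : SpinIndex N) (i : Fin N) : Fin N :=
  ⟨if (i : ℕ) < 2 * k then (if (i : ℕ) % 2 = 0 then (i : ℕ) + 1 else (i : ℕ) - 1) else i, by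
    have := two_mul_le k
    have := i.2
    split_ifs <;> omega⟩

theorem partner_val (k : SpinIndex N) (i : Fin N) : (partner k i : ℕ) =
    if (i : ℕ) < 2 * k then (if (i : ℕ) % 2 = 0 then (i : ℕ) + 1 else (i : ℕ) - 1) else i := rfl

theorem partner_partner (k : SpinIndex N) (i : Fin N) : partner k (partner k i) = i := by
  ext
  simp only [partner_val]
  split_ifs <;> omega

theorem colOf_partner (k : SpinIndex N) (i : Fin N) : colOf k (partner k i) = colOf k i := by
  simp only [partner_val, colOf]
  split_ifs <;> omega

theorem partner_ne {k : SpinIndex N} {i : Fin N} (hi : (i : ℕ) < 2 * k) : partner k i ≠ i := by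
  intro h
  have := congrArg Fin.val h
  simp only [partner_val] at this
  split_ifs at this <;> omega

theorem partner_lt {k : SpinIndex N} {i : Fin N} :
    (partner k i : ℕ) < 2 * k ↔ (i : ℕ) < 2 * k := by
  simp only [partner_val]
  split_ifs <;> omega

theorem rowOf_le (k i : ℕ) : rowOf k i ≤ 1 := by
  simp only [rowOf]
  split_ifs <;> omega

theorem rowOf_partner {k : SpinIndex N} {i : Fin N} (hi : (i : ℕ) < 2 * k) :
    rowOf k (partner k i) = 1 - rowOf k i := by
  simp only [partner_val, rowOf]
  split_ifs <;> omega

/-- Two-row shapes have columns with at most two entries. This makes the column group a product of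
transpositions. -/
theorem eq_or_eq_partner {k : SpinIndex N} {i j : Fin N} (h : colOf k j = colOf k i) :
    j = i ∨ j = partner k i := by
  simp only [Fin.ext_iff, partner_val]
  simp only [colOf] at h
  split_ifs at * <;> omega

/-- A row assignment with two different rows from `{0, 1}` in each column of length two can be
brought to the standard one there by a column permutation. -/
theorem exists_colPerm_eq_rowOf (k : SpinIndex N) (r : Fin N → ℕ)
    (h1 : ∀ i : Fin N, (i : ℕ) < 2 * k → r i ≤ 1)
    (h2 : ∀ i : Fin N, (i : ℕ) < 2 * k → r (partner k i) ≠ r i) :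
    ∃ π ∈ colPerms k, ∀ i : Fin N, if (i : ℕ) < 2 * k then r (π i) = rowOf k i else π i = i := by
  -- The two entries of a column are in the standard rows simultaneously or not at all. Hence `f`,
  -- which flips exactly the wrong columns, is an involution.
  have hiff : ∀ i : Fin N, (i : ℕ) < 2 * k →
      (r (partner k i) = rowOf k (partner k i) ↔ r i = rowOf k i) := fun i hi => by
    have := h1 i hi
    have := h1 _ (partner_lt.2 hi)
    have := h2 i hi
    have := rowOf_le k i
    rw [rowOf_partner hi]
    omega
  let f : Fin N → Fin N := fun i => if r i = rowOf k i then i else partner k i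
  have hf : Function.Involutive f := fun i => by
    by_cases hi : (i : ℕ) < 2 * k
    · by_cases h : r i = rowOf k i
      · simp [f, h]
      · simp [f, h, hiff i hi, partner_partner]
    · have : partner k i = i := by ext; simp [partner_val, hi]
      simp [f, this]
  refine ⟨hf.toPerm, mem_colPerms.2 fun i => ?_, fun i => ?_⟩
  · simp only [Function.Involutive.coe_toPerm, f]
    split_ifs
    · rfl
    · exact colOf_partner k i
  · simp only [Function.Involutive.coe_toPerm, f]
    by_cases hi : (i : ℕ) < 2 * k
    · rw [if_pos hi]
      split_ifs with h
      · exact h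
      · have := h1 i hi
        have := h1 _ (partner_lt.2 hi)
        have := h2 i hi
        have := rowOf_le k i
        omega
    · have : partner k i = i := by ext; simp [partner_val, hi]
      simp [hi, this]

/-- The column group is generated by the transpositions of the columns. -/
theorem colPerms_induction {k : SpinIndex N} {P : Equiv.Perm (Fin N) → Prop} (one : P 1)
    (mul : ∀ (i : Fin N) π, (i : ℕ) < 2 * k → P π → P (Equiv.swap i (partner k i) * π))
    {π : Equiv.Perm (Fin N)} (hπ : π ∈ colPerms k) : P π := by
  induction hn : π.support.card using Nat.strong_induction_on generalizing π with
  | _ n ih =>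
    by_cases h : π = 1
    · rw [h]; exact one
    · obtain ⟨i, hi⟩ : ∃ i, π i ≠ i := by
        by_contra! hc
        exact h (Equiv.ext hc)
      have hp : π i = partner k i :=
        (eq_or_eq_partner (mem_colPerms.1 hπ i)).resolve_left hi
      have hlt : (i : ℕ) < 2 * k := by
        by_contra hc
        apply hi
        rw [hp]
        ext
        simp [partner_val, hc]
      have hs : Equiv.swap i (partner k i) ∈ colPerms k :=
        swap_mem_colPerms (colOf_partner k i).symm
      have := ih _ (by
        rw [← hn, ← hp]
        exact Equiv.Perm.card_support_swap_mul hi) (mul_mem_colPerms hs hπ) rfl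
      have := mul i _ hlt this
      rwa [← mul_assoc, Equiv.swap_mul_self, one_mul] at this

/-! ### The column antisymmetrizer -/

/-- The sign of a permutation as a complex number. -/
def csign (π : Equiv.Perm (Fin N)) : ℂ := ((Equiv.Perm.sign π : ℤ) : ℂ)

theorem csign_mul (π τ : Equiv.Perm (Fin N)) : csign (π * τ) = csign π * csign τ := by
  simp [csign]

theorem csign_one : csign (1 : Equiv.Perm (Fin N)) = 1 := by simp [csign]

theorem csign_mul_self (π : Equiv.Perm (Fin N)) : csign π * csign π = 1 := by
  rcases Int.units_eq_one_or (Equiv.Perm.sign π) with h | h <;> simp [csign, h]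

theorem csign_swap {i j : Fin N} (h : i ≠ j) : csign (Equiv.swap i j) = -1 := by
  simp [csign, Equiv.Perm.sign_swap h]

theorem star_csign (π : Equiv.Perm (Fin N)) : starRingEnd ℂ (csign π) = csign π := by
  simp [csign]

section Antisymmetrizer

variable {V W : Type*} [AddCommMonoid V] [Module ℂ V] [AddCommMonoid W] [Module ℂ W]

/-- The signed sum over the column group of `stdTableau k`. -/
def colAntisymm (ρ : Representation ℂ (Equiv.Perm (Fin N)) V) (k : SpinIndex N) :
    Module.End ℂ V :=
  ∑ π ∈ colPerms k, csign π • ρ π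

variable {ρ : Representation ℂ (Equiv.Perm (Fin N)) V}
  {ρ' : Representation ℂ (Equiv.Perm (Fin N)) W} {k : SpinIndex N}

theorem colAntisymm_apply (v : V) :
    colAntisymm ρ k v = ∑ π ∈ colPerms k, csign π • ρ π v := by
  simp [colAntisymm]

theorem colAntisymm_apply_rep {τ : Equiv.Perm (Fin N)} (hτ : τ ∈ colPerms k) (v : V) :
    colAntisymm ρ k (ρ τ v) = csign τ • colAntisymm ρ k v := by
  rw [colAntisymm_apply, colAntisymm_apply, Finset.smul_sum]
  refine Finset.sum_bij (fun π _ => π * τ) (fun π hπ => mul_mem_colPerms hπ hτ)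
    (fun _ _ _ _ h => mul_right_cancel h)
    (fun π hπ => ⟨π * τ⁻¹, mul_mem_colPerms hπ (inv_mem_colPerms hτ), by simp⟩) fun π _ => ?_
  rw [smul_smul, csign_mul, mul_comm, mul_assoc, csign_mul_self, mul_one, map_mul,
    Module.End.mul_apply]

/-- Each term contributes the square of a sign. This trades the value of a sign-equivariant map on
an antisymmetrized vector for its value on the vector itself. -/
theorem map_colAntisymm {g : V →ₗ[ℂ] W} (hg : ∀ τ ∈ colPerms k, ∀ v, g (ρ τ v) = csign τ • g v)
    (v : V) : g (colAntisymm ρ k v) = ((colPerms k).card : ℂ) • g v := by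
  rw [colAntisymm_apply, map_sum, Finset.sum_congr rfl (g := fun _ => g v)]
  · simp [Nat.cast_smul_eq_nsmul]
  · intro π hπ
    rw [map_smul, hg π hπ, smul_smul, csign_mul_self, one_smul]

theorem colAntisymm_colAntisymm (v : V) :
    colAntisymm ρ k (colAntisymm ρ k v) = ((colPerms k).card : ℂ) • colAntisymm ρ k v :=
  map_colAntisymm (fun _ hτ v => colAntisymm_apply_rep hτ v) v

/-- A transposition in the column group negates the antisymmetrized vector, while here it also fixes
it. -/
theorem colAntisymm_eq_zero {i : Fin N} (hi : (i : ℕ) < 2 * k) {v : V}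
    (hv : ρ (Equiv.swap i (partner k i)) v = v) : colAntisymm ρ k v = 0 := by
  have h := colAntisymm_apply_rep (ρ := ρ) (swap_mem_colPerms (colOf_partner k i).symm) v
  rw [hv, csign_swap (partner_ne hi).symm] at h
  have h2 : (2 : ℂ) • colAntisymm ρ k v = 0 := by
    rw [two_smul]
    nth_rewrite 1 [h]
    nth_rewrite 2 [← one_smul ℂ (colAntisymm ρ k v)]
    rw [← add_smul, neg_add_cancel, zero_smul]
  rw [← inv_smul_smul₀ (two_ne_zero (α := ℂ)) (colAntisymm ρ k v), h2, smul_zero]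

theorem colAntisymm_map {f : V →ₗ[ℂ] W} (hf : ∀ σ v, f (ρ σ v) = ρ' σ (f v)) (v : V) :
    colAntisymm ρ' k (f v) = f (colAntisymm ρ k v) := by
  simp [colAntisymm_apply, map_sum, hf]

end Antisymmetrizer

/-! ### Polytabloids -/

theorem tabloidRep_single (σ : Equiv.Perm (Fin N)) (r : Fin N → ℕ) (a : ℂ) :
    tabloidRep N σ (Finsupp.single r a) = Finsupp.single (r ∘ ⇑σ⁻¹) a := by
  simp [tabloidRep, Finsupp.mapDomain_single]

theorem tabloidRep_apply (σ : Equiv.Perm (Fin N)) (v : (Fin N → ℕ) →₀ ℂ) (r : Fin N → ℕ) :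
    tabloidRep N σ v r = v (r ∘ σ) := by
  have hinj : Function.Injective fun r : Fin N → ℕ => r ∘ ⇑σ⁻¹ :=
    σ⁻¹.surjective.injective_comp_right
  have : r = (r ∘ σ) ∘ ⇑σ⁻¹ := by ext; simp
  conv_lhs => rw [this]
  exact Finsupp.mapDomain_apply hinj v _

/-- The standard row assignment. -/
def rowFn (k : SpinIndex N) : Fin N → ℕ := fun i => rowOf k i

theorem polytabloid_stdTableau (k : SpinIndex N) :
    polytabloid (stdTableau k) = colAntisymm (tabloidRep N) k (Finsupp.single (rowFn k) 1) := by
  simp only [colAntisymm_apply, tabloidRep_single]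
  rfl

theorem polytabloid_eq (k : SpinIndex N) (T : Tableau (shape k) N) :
    ∃ σ, polytabloid T = tabloidRep N σ (polytabloid (stdTableau k)) := by
  refine ⟨(stdTableau k).trans T.symm, ?_⟩
  rw [tabloidRep_polytabloid]
  congr 1
  ext i : 1
  simp

/-- The polytabloid of `stdTableau k` as an element of the Specht module. -/
def stdPoly (k : SpinIndex N) : Specht N (shape k) :=
  ⟨polytabloid (stdTableau k), Submodule.subset_span ⟨_, rfl⟩⟩

theorem spechtRep_coe (k : SpinIndex N) (σ : Equiv.Perm (Fin N)) (w : Specht N (shape k)) :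
    ((spechtRep N (shape k) σ w : Specht N (shape k)) : (Fin N → ℕ) →₀ ℂ) = tabloidRep N σ w :=
  rfl

theorem spechtRep_mul (k : SpinIndex N) (σ τ : Equiv.Perm (Fin N)) (w : Specht N (shape k)) :
    spechtRep N (shape k) (σ * τ) w = spechtRep N (shape k) σ (spechtRep N (shape k) τ w) := by
  rw [map_mul]
  rfl

/-- Every polytabloid is a translate of the standard one. The subspace `p` need not be invariant, so
kernels and preimages of single operators qualify. -/
theorem specht_le {k : SpinIndex N} {p : Submodule ℂ ((Fin N → ℕ) →₀ ℂ)}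
    (h : ∀ σ, tabloidRep N σ (polytabloid (stdTableau k)) ∈ p) :
    (spechtSub N (shape k)).toSubmodule ≤ p := by
  refine Submodule.span_le.2 ?_
  rintro _ ⟨T, rfl⟩
  obtain ⟨σ, hσ⟩ := polytabloid_eq k T
  change polytabloid T ∈ p
  rw [hσ]
  exact h σ

/-- Linear maps that agree on the translates of one polytabloid agree on the Specht module. -/
theorem specht_hom_ext {V : Type*} [AddCommMonoid V] [Module ℂ V] {k : SpinIndex N}
    {f g : Specht N (shape k) →ₗ[ℂ] V}
    (h : ∀ σ, f (spechtRep N _ σ (stdPoly k)) = g (spechtRep N _ σ (stdPoly k))) : f = g := by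
  ext w
  have hw : (w : (Fin N → ℕ) →₀ ℂ) ∈
      (LinearMap.eqLocus f g).map (spechtSub N (shape k)).toSubmodule.subtype :=
    specht_le (p := (LinearMap.eqLocus f g).map (spechtSub N (shape k)).toSubmodule.subtype)
      (fun σ => Submodule.mem_map.2 ⟨spechtRep N _ σ (stdPoly k), h σ, rfl⟩) w.2
  obtain ⟨w', hw', he⟩ := hw
  obtain rfl : w' = w := Subtype.ext he
  exact hw'

theorem card_rowFn (k : SpinIndex N) :
    (Finset.univ.filter fun i => rowFn k i = 1).card = k := by
  have hk := two_mul_le k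
  have : (Finset.univ.filter fun i => rowFn k i = 1) =
      Finset.univ.map ⟨fun j : Fin k => (⟨2 * j + 1, by omega⟩ : Fin N),
        fun a b h => by simpa [Fin.ext_iff] using h⟩ := by
    ext i
    rw [Finset.mem_filter, Finset.mem_map]
    constructor
    · rintro ⟨-, h⟩
      simp only [rowFn, rowOf] at h
      have h' : (i : ℕ) < 2 * k ∧ (i : ℕ) % 2 = 1 := by split_ifs at h; omega
      refine ⟨⟨i / 2, by omega⟩, Finset.mem_univ _, Fin.ext ?_⟩
      change 2 * ((i : ℕ) / 2) + 1 = i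
      omega
    · rintro ⟨j, -, rfl⟩
      have := j.2
      refine ⟨Finset.mem_univ _, ?_⟩
      change rowOf k (2 * j + 1) = 1
      simp only [rowOf]
      split_ifs <;> omega
  rw [this, Finset.card_map, Finset.card_univ, Fintype.card_fin]

theorem card_rowFn_comp (k : SpinIndex N) (σ : Equiv.Perm (Fin N)) :
    (Finset.univ.filter fun i => rowFn k (σ i) = 1).card = k := by
  rw [← card_rowFn k]
  exact Finset.card_bij (fun i _ => σ i) (by simp) (fun _ _ _ _ h => σ.injective h)
    (fun j hj => ⟨σ⁻¹ j, by simpa using hj, by simp⟩)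

/-- If some column of length two has both entries in the same row of the tabloid, its transposition
fixes the tabloid and the result is zero. Otherwise a column permutation puts the k lower entries of
the tableau inside the second row of the tabloid, which has only l ≤ k entries. So l = k and the
tabloid is a column translate of the standard one. -/
theorem colAntisymm_single {k l : SpinIndex N} (hlk : l ≤ k) (σ : Equiv.Perm (Fin N)) :
    colAntisymm (tabloidRep N) k (Finsupp.single (rowFn l ∘ σ) 1) = 0 ∨
      l = k ∧ ∃ c : ℂ, colAntisymm (tabloidRep N) k (Finsupp.single (rowFn l ∘ σ) 1) =
        c • polytabloid (stdTableau k) := by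
  by_cases h : ∀ i : Fin N, (i : ℕ) < 2 * k → (rowFn l ∘ σ) (partner k i) ≠ (rowFn l ∘ σ) i
  · obtain ⟨π, hπ, hr⟩ := exists_colPerm_eq_rowOf k (rowFn l ∘ σ) (fun i _ => rowOf_le _ _) h
    have hsub : (Finset.univ.filter fun i => rowFn k i = 1) ⊆
        Finset.univ.filter fun i => rowFn l ((σ * π) i) = 1 := fun i hi => by
      rw [Finset.mem_filter] at hi ⊢
      replace hi := hi.2
      refine ⟨Finset.mem_univ _, ?_⟩
      have hi' : (i : ℕ) < 2 * k := by
        by_contra hc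
        simp [rowFn, rowOf, hc] at hi
      have := hr i
      rw [if_pos hi'] at this
      rw [← hi]
      exact this
    have hcard := Finset.card_le_card hsub
    rw [card_rowFn, card_rowFn_comp] at hcard
    have hkl : l = k := le_antisymm hlk hcard
    refine Or.inr ⟨hkl, csign π, ?_⟩
    have heq := Finset.eq_of_subset_of_card_le hsub (by rw [card_rowFn, card_rowFn_comp, hkl])
    have hfun : rowFn l ∘ σ = rowFn k ∘ ⇑π⁻¹ := by
      have : rowFn l ∘ ⇑(σ * π) = rowFn k := by
        ext i
        have h1 : rowFn k i = 1 ↔ rowFn l ((σ * π) i) = 1 := by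
          have := Finset.ext_iff.1 heq i
          rw [Finset.mem_filter, Finset.mem_filter] at this
          simpa only [Finset.mem_univ, true_and] using this
        have h2 : rowFn l ((σ * π) i) ≤ 1 := rowOf_le _ _
        have h3 : rowFn k i ≤ 1 := rowOf_le _ _
        simp only [Function.comp_apply]
        omega
      rw [← this]
      ext i
      simp
    rw [hfun, ← tabloidRep_single, colAntisymm_apply_rep hπ, polytabloid_stdTableau]
  · push Not at h
    obtain ⟨i, hi, he⟩ := h
    refine Or.inl (colAntisymm_eq_zero hi ?_)
    rw [tabloidRep_single, Equiv.swap_inv]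
    congr 1
    ext j
    simp only [Function.comp_apply] at he ⊢
    rw [Equiv.swap_apply_def]
    split_ifs with h1 h2
    · rw [h1, he]
    · rw [h2, he]
    · rfl

theorem tabloidRep_polytabloid_eq_sum (l : SpinIndex N) (σ : Equiv.Perm (Fin N)) :
    tabloidRep N σ (polytabloid (stdTableau l)) =
      ∑ π ∈ colPerms l, csign π • Finsupp.single (rowFn l ∘ ⇑(σ * π)⁻¹) (1 : ℂ) := by
  rw [polytabloid_stdTableau, colAntisymm_apply, map_sum]
  refine Finset.sum_congr rfl fun π _ => ?_
  rw [map_smul, ← Module.End.mul_apply, ← map_mul, tabloidRep_single]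

theorem colAntisymm_specht_of_lt {k l : SpinIndex N} (hlk : l < k) (w : Specht N (shape l)) :
    colAntisymm (tabloidRep N) k w = 0 := by
  refine specht_le (p := LinearMap.ker (colAntisymm (tabloidRep N) k)) (fun σ => ?_) w.2
  rw [LinearMap.mem_ker, tabloidRep_polytabloid_eq_sum, map_sum]
  refine Finset.sum_eq_zero fun π _ => ?_
  rw [map_smul, (colAntisymm_single hlk.le _).resolve_right (fun h => hlk.ne h.1), smul_zero]

theorem colAntisymm_coe (j k : SpinIndex N) (w : Specht N (shape k)) :
    ((colAntisymm (spechtRep N (shape k)) j w : Specht N (shape k)) : (Fin N → ℕ) →₀ ℂ) =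
      colAntisymm (tabloidRep N) j w :=
  (colAntisymm_map (ρ := spechtRep N (shape k)) (ρ' := tabloidRep N) (k := j)
    (f := (spechtSub N (shape k)).toSubmodule.subtype) (fun _ _ => rfl) w).symm

/-- A rank-one property: each tabloid of the same shape is sent to a multiple of the standard
polytabloid. It plays the part of irreducibility in Schur's lemma. -/
theorem colAntisymm_specht {k : SpinIndex N} (w : Specht N (shape k)) :
    ∃ c : ℂ, colAntisymm (spechtRep N (shape k)) k w = c • stdPoly k := by
  have : colAntisymm (tabloidRep N) k w ∈ Submodule.span ℂ {polytabloid (stdTableau k)} := by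
    refine specht_le (p := (Submodule.span ℂ {polytabloid (stdTableau k)}).comap
      (colAntisymm (tabloidRep N) k)) (fun σ => ?_) w.2
    rw [Submodule.mem_comap, tabloidRep_polytabloid_eq_sum, map_sum]
    refine Submodule.sum_mem _ fun π _ => ?_
    rw [map_smul]
    refine Submodule.smul_mem _ _ ?_
    rcases colAntisymm_single (le_refl k) (σ * π)⁻¹ with h | ⟨-, c, h⟩
    · rw [h]; exact zero_mem _
    · rw [h]; exact Submodule.smul_mem _ _ (Submodule.mem_span_singleton_self _)
  obtain ⟨c, hc⟩ := Submodule.mem_span_singleton.1 this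
  exact ⟨c, Subtype.ext ((colAntisymm_coe k k w).trans hc.symm)⟩

theorem colAntisymm_stdPoly (k : SpinIndex N) :
    colAntisymm (spechtRep N (shape k)) k (stdPoly k) =
      ((colPerms k).card : ℂ) • stdPoly k := by
  apply Subtype.ext
  rw [colAntisymm_coe]
  change colAntisymm _ k (polytabloid (stdTableau k)) = _ • polytabloid (stdTableau k)
  rw [polytabloid_stdTableau, colAntisymm_colAntisymm]

/-- Only the identity column permutation fixes the standard tabloid, because moving an entry within
its column changes its row. -/
theorem polytabloid_apply_rowFn (k : SpinIndex N) :
    polytabloid (stdTableau k) (rowFn k) = 1 := by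
  rw [polytabloid_stdTableau, colAntisymm_apply, Finsupp.finsetSum_apply,
    Finset.sum_eq_single_of_mem 1 (one_mem_colPerms k)]
  · simp [csign_one]
  · intro π hπ hne
    rw [tabloidRep_single, Finsupp.smul_apply, Finsupp.single_apply, if_neg, smul_zero]
    intro h
    apply hne
    ext i : 1
    rcases eq_or_eq_partner (mem_colPerms.1 hπ i) with h1 | h1
    · exact h1
    · by_cases hi : (i : ℕ) < 2 * k
      · have h2 := congrFun h (π i)
        rw [Function.comp_apply, ← Equiv.Perm.mul_apply, inv_mul_cancel, Equiv.Perm.one_apply, h1,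
          rowFn, rowFn, rowOf_partner hi] at h2
        have := rowOf_le k i
        omega
      · rw [h1]
        ext
        simp [partner_val, hi]

/-- The functional `v ↦ ⟨w, v⟩` for the standard hermitian form on combinations of tabloids. -/
def tabloidPairing (w : (Fin N → ℕ) →₀ ℂ) : ((Fin N → ℕ) →₀ ℂ) →ₗ[ℂ] ℂ :=
  Finsupp.linearCombination ℂ fun r => starRingEnd ℂ (w r)

theorem tabloidPairing_self {w : (Fin N → ℕ) →₀ ℂ} (h : tabloidPairing w w = 0) : w = 0 := by
  rw [tabloidPairing, Finsupp.linearCombination_apply, Finsupp.sum] at h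
  simp only [smul_eq_mul, Complex.mul_conj] at h
  rw [← Complex.ofReal_sum, Complex.ofReal_eq_zero,
    Finset.sum_eq_zero_iff_of_nonneg fun r _ => Complex.normSq_nonneg _] at h
  ext r
  by_contra hr
  exact hr (Complex.normSq_eq_zero.1 (h r (Finsupp.mem_support_iff.2 hr)))

/-- The antisymmetrizer is self-adjoint for the tabloid form and permutations are unitary, so both
move to the other argument. -/
theorem tabloidPairing_polytabloid (k : SpinIndex N) (w : (Fin N → ℕ) →₀ ℂ)
    (σ : Equiv.Perm (Fin N)) :
    tabloidPairing w (tabloidRep N σ (polytabloid (stdTableau k))) =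
      starRingEnd ℂ (colAntisymm (tabloidRep N) k (tabloidRep N σ⁻¹ w) (rowFn k)) := by
  simp only [colAntisymm_apply, Finsupp.finsetSum_apply, Finsupp.smul_apply, tabloidRep_apply,
    map_sum, smul_eq_mul, map_mul, star_csign]
  rw [tabloidRep_polytabloid_eq_sum, map_sum]
  refine Finset.sum_bij (fun π _ => π⁻¹) (fun π hπ => inv_mem_colPerms hπ)
    (fun _ _ _ _ h => inv_injective h)
    (fun π hπ => ⟨π⁻¹, inv_mem_colPerms hπ, by simp⟩) fun π _ => ?_
  rw [map_smul, tabloidPairing, Finsupp.linearCombination_single, one_smul, smul_eq_mul]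
  congr 1
  simp [csign]

/-- An element of the Specht module whose translates are all killed by the antisymmetrizer
vanishes. -/
theorem specht_eq_zero {k : SpinIndex N} {w : Specht N (shape k)}
    (h : ∀ σ, colAntisymm (tabloidRep N) k (tabloidRep N σ w) = 0) : w = 0 := by
  -- By adjointness `w` is orthogonal to every translate of the polytabloid, hence to the whole
  -- Specht module and in particular to itself.
  have hw : (w : (Fin N → ℕ) →₀ ℂ) ∈
      LinearMap.ker (tabloidPairing (w : (Fin N → ℕ) →₀ ℂ)) := by
    refine specht_le (fun σ => ?_) w.2
    rw [LinearMap.mem_ker, tabloidPairing_polytabloid, h, Finsupp.zero_apply, map_zero]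
  exact Subtype.ext (tabloidPairing_self (LinearMap.mem_ker.1 hw))

/-! ### Schur's lemma for the Specht modules -/

/-- The antisymmetrizer of the larger index kills the module of the smaller one. For k < l it kills
the source, so it kills all translates of any image vector, which must vanish by positivity. For k >
l it kills the target but rescales the generator of the source, so the generator maps to zero. -/
theorem specht_hom_eq_zero {k l : SpinIndex N} (hkl : k ≠ l)
    (f : Specht N (shape k) →ₗ[ℂ] Specht N (shape l))
    (hf : ∀ σ w, f (spechtRep N _ σ w) = spechtRep N _ σ (f w)) : f = 0 := by
  have hcoe : ∀ σ w, (spechtSub N (shape l)).toSubmodule.subtype.comp f (spechtRep N _ σ w) =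
      tabloidRep N σ ((spechtSub N (shape l)).toSubmodule.subtype.comp f w) := fun σ w => by
    rw [LinearMap.comp_apply, hf]
    rfl
  rcases lt_or_gt_of_ne hkl with h | h
  · ext w : 1
    refine specht_eq_zero fun σ => ?_
    have h1 := colAntisymm_map (ρ := spechtRep N (shape k)) (ρ' := tabloidRep N) (k := l)
      (f := (spechtSub N (shape l)).toSubmodule.subtype.comp f) hcoe
      (spechtRep N _ σ w)
    rw [show colAntisymm (spechtRep N (shape k)) l (spechtRep N _ σ w) = 0 from
      Subtype.ext ((colAntisymm_coe _ _ _).trans (colAntisymm_specht_of_lt h _)), map_zero,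
      hcoe] at h1
    exact h1
  · refine specht_hom_ext (f := f) (g := 0) fun σ => ?_
    have h1 := colAntisymm_map (ρ := spechtRep N (shape k)) (ρ' := tabloidRep N) (k := k)
      (f := (spechtSub N (shape l)).toSubmodule.subtype.comp f) hcoe
      (stdPoly k)
    rw [colAntisymm_stdPoly, map_smul, LinearMap.comp_apply, Submodule.subtype_apply,
      colAntisymm_specht_of_lt h] at h1
    have h2 : f (stdPoly k) = 0 :=
      Subtype.ext ((smul_eq_zero.1 h1.symm).resolve_left (colPerms_card_ne_zero k))
    rw [hf, h2, map_zero, LinearMap.zero_apply]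

/-- The image of the generator is, up to a nonzero factor, in the range of the antisymmetrizer,
hence a multiple of the generator. Cyclicity does the rest. -/
theorem specht_hom_eq_smul {k : SpinIndex N}
    (f : Specht N (shape k) →ₗ[ℂ] Specht N (shape k))
    (hf : ∀ σ w, f (spechtRep N _ σ w) = spechtRep N _ σ (f w)) :
    ∃ c : ℂ, ∀ w, f w = c • w := by
  obtain ⟨c, hc⟩ := colAntisymm_specht (f (stdPoly k))
  have h1 := colAntisymm_map (V := Specht N (shape k)) (W := Specht N (shape k)) (k := k) (f := f) hf
    (stdPoly k)
  rw [colAntisymm_stdPoly, map_smul, hc] at h1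
  have h2 : f (stdPoly k) = (((colPerms k).card : ℂ)⁻¹ * c) • stdPoly k := by
    rw [mul_smul, h1, inv_smul_smul₀ (colPerms_card_ne_zero k)]
  refine ⟨((colPerms k).card : ℂ)⁻¹ * c, fun w => ?_⟩
  refine LinearMap.congr_fun (specht_hom_ext (f := f)
    (g := (((colPerms k).card : ℂ)⁻¹ * c) • LinearMap.id) fun σ => ?_) w
  rw [hf, h2, map_smul]
  rfl

/-! ### Homomorphisms into multiples of a representation -/

section Multiple

variable {ι α V W W' : Type*} [AddCommMonoid V] [Module ℂ V] [AddCommMonoid W] [Module ℂ W]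
  [AddCommMonoid W'] [Module ℂ W'] [DecidableEq ι] (b : Module.Basis ι ℂ V)

theorem equivFinsuppOfBasisLeft_map (g : W →ₗ[ℂ] W) (x : V ⊗[ℂ] W) (i : ι) :
    TensorProduct.equivFinsuppOfBasisLeft b (TensorProduct.map LinearMap.id g x) i =
      g (TensorProduct.equivFinsuppOfBasisLeft b x i) := by
  induction x with
  | zero => simp
  | add x y hx hy => simp [map_add, hx, hy]
  | tmul v w => simp

/-- The `i`-th coordinate of a linear map into a tensor product. -/
def coordHom (f : W →ₗ[ℂ] V ⊗[ℂ] W') (i : ι) : W →ₗ[ℂ] W' :=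
  Finsupp.lapply i ∘ₗ (TensorProduct.equivFinsuppOfBasisLeft b).toLinearMap ∘ₗ f

theorem coordHom_apply (f : W →ₗ[ℂ] V ⊗[ℂ] W') (i : ι) (w : W) :
    coordHom b f i w = TensorProduct.equivFinsuppOfBasisLeft b (f w) i := rfl

theorem coordHom_comm (f : W →ₗ[ℂ] V ⊗[ℂ] W') {g : W →ₗ[ℂ] W} {g' : W' →ₗ[ℂ] W'}
    (hf : ∀ w, f (g w) = TensorProduct.map LinearMap.id g' (f w)) (i : ι) (w : W) :
    coordHom b f i (g w) = g' (coordHom b f i w) := by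
  rw [coordHom_apply, hf, equivFinsuppOfBasisLeft_map, coordHom_apply]

/-- Every coordinate of `f` in the basis `b` is itself an equivariant map between `W` and `W'`. -/
theorem hom_tensor_eq_zero (b : Module.Basis ι ℂ V) {g : α → W →ₗ[ℂ] W} {g' : α → W' →ₗ[ℂ] W'}
    (h : ∀ f : W →ₗ[ℂ] W', (∀ a w, f (g a w) = g' a (f w)) → f = 0)
    (f : W →ₗ[ℂ] V ⊗[ℂ] W')
    (hf : ∀ a w, f (g a w) = TensorProduct.map LinearMap.id (g' a) (f w)) (w : W) : f w = 0 := by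
  apply (TensorProduct.equivFinsuppOfBasisLeft b).injective
  ext1 i
  rw [map_zero, ← coordHom_apply, h _ fun a => coordHom_comm b f (hf a) i]
  rfl

/-- Contraction of the second tensor factor with a functional. -/
def contract (V : Type*) [AddCommMonoid V] [Module ℂ V] (ψ : W →ₗ[ℂ] ℂ) :
    V ⊗[ℂ] W →ₗ[ℂ] V :=
  (TensorProduct.rid ℂ V).toLinearMap ∘ₗ ψ.lTensor V

theorem contract_tmul (ψ : W →ₗ[ℂ] ℂ) (v : V) (w : W) :
    contract V ψ (v ⊗ₜ w) = ψ w • v := by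
  simp [contract]

theorem repr_contract (ψ : W →ₗ[ℂ] ℂ) (x : V ⊗[ℂ] W) (i : ι) :
    b.repr (contract V ψ x) i = ψ (TensorProduct.equivFinsuppOfBasisLeft b x i) := by
  induction x with
  | zero => simp
  | add x y hx hy => simp [map_add, hx, hy]
  | tmul v w => simp [contract_tmul, mul_comm]

/-- Each coordinate of `f` is a scalar, recovered by evaluating at `w₀` and applying `ψ`.
Contraction collects these scalars into one vector of `V`, which is visibly linear in `f`. -/
theorem hom_tensor_eq_tmul (b : Module.Basis ι ℂ V) {g : α → W →ₗ[ℂ] W}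
    (h : ∀ f : W →ₗ[ℂ] W, (∀ a w, f (g a w) = g a (f w)) → ∃ c : ℂ, ∀ w, f w = c • w)
    (f : W →ₗ[ℂ] V ⊗[ℂ] W)
    (hf : ∀ a w, f (g a w) = TensorProduct.map LinearMap.id (g a) (f w))
    {ψ : W →ₗ[ℂ] ℂ} {w₀ : W} (hψ : ψ w₀ = 1) (w : W) :
    f w = contract V ψ (f w₀) ⊗ₜ w := by
  apply (TensorProduct.equivFinsuppOfBasisLeft b).injective
  ext1 i
  obtain ⟨c, hc⟩ := h _ fun a => coordHom_comm b f (hf a) i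
  rw [TensorProduct.equivFinsuppOfBasisLeft_apply_tmul_apply, repr_contract, ← coordHom_apply,
    ← coordHom_apply, hc, hc, map_smul, hψ, smul_eq_mul, mul_one]

end Multiple

/-- The coefficient of the standard tabloid of shape `(N - k, k)`. -/
def stdCoeff (k : SpinIndex N) : Specht N (shape k) →ₗ[ℂ] ℂ :=
  Finsupp.lapply (rowFn k) ∘ₗ (spechtSub N (shape k)).toSubmodule.subtype

theorem stdCoeff_stdPoly (k : SpinIndex N) : stdCoeff k (stdPoly k) = 1 :=
  polytabloid_apply_rowFn k

/-! ### The commutant of the symmetric group -/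

section Commutant

variable (B : Module.End ℂ (⨁ k : SpinIndex N, Sector N k))

/-- The map `w ↦ B (p ⊗ w)` between the Specht module labelled by `k` and the `l`-th sector. -/
def blockHom (k l : SpinIndex N) (p : SpinIrrep (twiceSpin k)) :
    Specht N (shape k) →ₗ[ℂ] Sector N l :=
  DirectSum.component ℂ _ (Sector N) l ∘ₗ B ∘ₗ DirectSum.lof ℂ _ (Sector N) k ∘ₗ
    TensorProduct.mk ℂ _ _ p

theorem blockHom_apply (k l : SpinIndex N) (p : SpinIrrep (twiceSpin k))
    (w : Specht N (shape k)) :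
    blockHom B k l p w = B (DirectSum.lof ℂ _ (Sector N) k (p ⊗ₜ w)) l := rfl

theorem sectorRep_one (k : SpinIndex N) (σ : Equiv.Perm (Fin N)) :
    sectorRep N k (1, σ) = TensorProduct.map LinearMap.id (spechtRep N (shape k) σ) := by
  refine TensorProduct.ext' fun p w => ?_
  change spinRep (twiceSpin k) 1 p ⊗ₜ[ℂ] _ = p ⊗ₜ[ℂ] _
  rw [map_one]
  rfl

variable {B}

theorem blockHom_comm (hB : ∀ σ, Commute B (Representation.directSum (sectorRep N) (1, σ)))
    (k l : SpinIndex N) (p : SpinIrrep (twiceSpin k)) (σ : Equiv.Perm (Fin N))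
    (w : Specht N (shape k)) :
    blockHom B k l p (spechtRep N _ σ w) =
      TensorProduct.map LinearMap.id (spechtRep N _ σ) (blockHom B k l p w) := by
  have h1 : DirectSum.lof ℂ _ (Sector N) k (p ⊗ₜ spechtRep N _ σ w) =
      Representation.directSum (sectorRep N) (1, σ)
        (DirectSum.lof ℂ _ (Sector N) k (p ⊗ₜ w)) := by
    rw [Representation.directSum_apply, DirectSum.lmap_lof, sectorRep_one]
    rfl
  have h2 := LinearMap.congr_fun (hB σ).eq (DirectSum.lof ℂ _ (Sector N) k (p ⊗ₜ w))
  rw [Module.End.mul_apply, Module.End.mul_apply] at h2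
  rw [blockHom_apply, blockHom_apply, h1, h2, Representation.directSum_apply,
    DirectSum.lmap_apply, sectorRep_one]

theorem exists_eq_blockDiagonal
    (hB : ∀ σ, Commute B (Representation.directSum (sectorRep N) (1, σ))) :
    ∃ A : ∀ k : SpinIndex N, Module.End ℂ (SpinIrrep (twiceSpin k)), B = blockDiagonal A := by
  classical
  -- The operator on V_J is found by testing `B` on p ⊗ e and contracting with the functional that
  -- takes the value 1 at e.
  refine ⟨fun k => contract _ (stdCoeff k) ∘ₗ DirectSum.component ℂ _ (Sector N) k ∘ₗ B ∘ₗ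
      DirectSum.lof ℂ _ (Sector N) k ∘ₗ (TensorProduct.mk ℂ _ _).flip (stdPoly k), ?_⟩
  refine DirectSum.linearMap_ext ℂ fun k => TensorProduct.ext' fun p w => ?_
  refine DFinsupp.ext fun l => ?_
  rw [LinearMap.comp_apply, LinearMap.comp_apply, blockDiagonal, DirectSum.lmap_lof,
    TensorProduct.map_tmul]
  by_cases hkl : k = l
  · subst hkl
    have := hom_tensor_eq_tmul (Module.Basis.ofVectorSpace ℂ (SpinIrrep (twiceSpin k)))
      (g := fun σ => spechtRep N (shape k) σ) specht_hom_eq_smul (blockHom B k k p)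
      (blockHom_comm hB k k p) (stdCoeff_stdPoly k) w
    rw [blockHom_apply] at this
    refine this.trans ?_
    exact (DirectSum.component.lof_self (M := Sector N) ℂ k _).symm
  · have := hom_tensor_eq_zero (Module.Basis.ofVectorSpace ℂ (SpinIrrep (twiceSpin l)))
      (g := fun σ => spechtRep N (shape k) σ) (g' := fun σ => spechtRep N (shape l) σ)
      (specht_hom_eq_zero hkl) (blockHom B k l p) (blockHom_comm hB k l p) w
    refine this.trans ?_
    symm
    exact (DirectSum.component.of (M := Sector N) ℂ l k _).trans (dif_neg hkl)

end Commutant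

theorem Decomposition.exists_blockDiagonal (Φ : Decomposition N) {H : Module.End ℂ (SpinSpace N)}
    (hH : ∀ σ : Equiv.Perm (Fin N), Commute H (sitePerm σ)) :
    ∃ A : ∀ k : SpinIndex N, Module.End ℂ (SpinIrrep (twiceSpin k)),
      Φ.toLinearEquiv.toLinearMap ∘ₗ H ∘ₗ Φ.toLinearEquiv.symm.toLinearMap =
        blockDiagonal A := by
  have h1 : ∀ σ : Equiv.Perm (Fin N), spinSpaceRep N (1, σ) = sitePerm σ := fun σ => by
    refine PiTensorProduct.ext (MultilinearMap.ext fun s => ?_)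
    change collective 1 (sitePerm σ (PiTensorProduct.tprod ℂ s)) = _
    rw [sitePerm_tprod, collective_tprod]
    simp [sitePerm_tprod]
  have h2 : ∀ σ x, Φ.toLinearEquiv (sitePerm σ x) =
      Representation.directSum (sectorRep N) (1, σ) (Φ.toLinearEquiv x) := fun σ x => by
    rw [← h1]
    exact LinearMap.congr_fun (Φ.isIntertwining' (1, σ)) x
  refine exists_eq_blockDiagonal fun σ => LinearMap.ext fun y => ?_
  obtain ⟨x, rfl⟩ := Φ.toLinearEquiv.surjective y
  rw [Module.End.mul_apply, Module.End.mul_apply, ← h2]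
  simp only [LinearMap.comp_apply, LinearEquiv.coe_coe, LinearEquiv.symm_apply_apply]
  exact (congrArg Φ.toLinearEquiv (LinearMap.congr_fun (hH σ).eq x)).trans (h2 σ (H x))

/-! ### The symmetric group on the spin space -/

theorem sitePerm_mul (σ τ : Equiv.Perm (Fin N)) (x : SpinSpace N) :
    sitePerm (σ * τ) x = sitePerm σ (sitePerm τ x) := by
  have : sitePerm (σ * τ) = sitePerm σ ∘ₗ sitePerm τ := by
    refine PiTensorProduct.ext (MultilinearMap.ext fun s => ?_)
    simp only [LinearMap.compMultilinearMap_apply, LinearMap.comp_apply, sitePerm_tprod,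
      mul_inv_rev, Equiv.Perm.mul_apply]
  rw [this, LinearMap.comp_apply]

theorem sitePerm_one (x : SpinSpace N) : sitePerm 1 x = x := by
  have : sitePerm (1 : Equiv.Perm (Fin N)) = LinearMap.id := by
    refine PiTensorProduct.ext (MultilinearMap.ext fun s => ?_)
    simp [sitePerm_tprod]
  rw [this, LinearMap.id_apply]

/-- The product basis of the spin space. -/
def spinBasis (t : Fin N → Fin 2) : SpinSpace N :=
  PiTensorProduct.tprod ℂ fun i => Pi.single (t i) 1

theorem sitePerm_spinBasis (σ : Equiv.Perm (Fin N)) (t : Fin N → Fin 2) :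
    sitePerm σ (spinBasis t) = spinBasis (t ∘ ⇑σ⁻¹) := by
  simp [spinBasis, sitePerm_tprod]

theorem spinBasis_hom_ext {W : Type*} [AddCommMonoid W] [Module ℂ W]
    {f g : SpinSpace N →ₗ[ℂ] W} (h : ∀ t, f (spinBasis t) = g (spinBasis t)) : f = g := by
  refine PiTensorProduct.ext (Module.Basis.ext_multilinear (fun _ => Pi.basisFun ℂ (Fin 2))
    fun t => ?_)
  simpa [spinBasis] using h t

/-! ### Antisymmetric maps on the spin space -/

/-- The number of spins in the second basis state. -/
def weight (t : Fin N → Fin 2) : ℕ := (Finset.univ.filter fun i => t i = 1).card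

theorem weight_comp (t : Fin N → Fin 2) (σ : Equiv.Perm (Fin N)) : weight (t ∘ σ) = weight t :=
  Finset.card_bij (fun i _ => σ i) (by simp) (fun _ _ _ _ h => σ.injective h)
    (fun j hj => ⟨σ⁻¹ j, by simpa using hj, by simp⟩)

/-- The map sending a row assignment `r` to the sum of the basis vectors of weight `q` that lie
above `r`. -/
def raise (q : ℕ) : ((Fin N → ℕ) →₀ ℂ) →ₗ[ℂ] SpinSpace N :=
  Finsupp.linearCombination ℂ fun r =>
    ∑ t : Fin N → Fin 2 with (∀ i, r i ≤ (t i : ℕ)) ∧ weight t = q, spinBasis t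

theorem raise_single (q : ℕ) (r : Fin N → ℕ) : raise q (Finsupp.single r 1) =
    ∑ t : Fin N → Fin 2 with (∀ i, r i ≤ (t i : ℕ)) ∧ weight t = q, spinBasis t := by
  rw [raise, Finsupp.linearCombination_single, one_smul]

/-- Lying above a row assignment and having a given weight are both preserved by relabelling the
sites. So `raise` carries each Specht module equivariantly into the spin space. -/
theorem raise_tabloidRep (q : ℕ) (σ : Equiv.Perm (Fin N)) (v : (Fin N → ℕ) →₀ ℂ) :
    raise q (tabloidRep N σ v) = sitePerm σ (raise q v) := by
  refine LinearMap.congr_fun (f := raise q ∘ₗ tabloidRep N σ) (g := sitePerm σ ∘ₗ raise q) ?_ v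
  refine Finsupp.lhom_ext' fun r => LinearMap.ext_ring ?_
  simp only [LinearMap.comp_apply, Finsupp.lsingle_apply, tabloidRep_single, raise_single,
    map_sum, sitePerm_spinBasis]
  refine Finset.sum_bij' (fun t _ => t ∘ σ) (fun t _ => t ∘ ⇑σ⁻¹) ?_ ?_ ?_ ?_ ?_
  · intro t ht
    rw [Finset.mem_filter] at ht ⊢
    refine ⟨Finset.mem_univ _, fun i => ?_, (weight_comp t σ).trans ht.2.2⟩
    simpa using ht.2.1 (σ i)
  · intro t ht
    rw [Finset.mem_filter] at ht ⊢
    exact ⟨Finset.mem_univ _, fun i => ht.2.1 _, (weight_comp t _).trans ht.2.2⟩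
  · intro t _
    ext i
    simp
  · intro t _
    ext i
    simp
  · intro t _
    congr 1
    ext i
    simp

/-- The assignments of weight `k + m` that agree with the standard rows on the columns of length
two. -/
def highSet (k : SpinIndex N) (m : ℕ) : Finset (Fin N → Fin 2) :=
  {t | (∀ i : Fin N, (i : ℕ) < 2 * k → (t i : ℕ) = rowFn k i) ∧ weight t = k + m}

theorem mem_highSet {k : SpinIndex N} {m : ℕ} {t : Fin N → Fin 2} : t ∈ highSet k m ↔
    (∀ i : Fin N, (i : ℕ) < 2 * k → (t i : ℕ) = rowFn k i) ∧ weight t = k + m := by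
  rw [highSet, Finset.mem_filter]
  simp

theorem weight_eq (k : SpinIndex N) {t : Fin N → Fin 2}
    (ht : ∀ i : Fin N, (i : ℕ) < 2 * k → (t i : ℕ) = rowFn k i) :
    weight t = k + (Finset.univ.filter fun i : Fin N => 2 * (k : ℕ) ≤ i ∧ t i = 1).card := by
  refine Eq.trans ?_ (congrArg (· + _) (card_rowFn k))
  rw [weight, ← Finset.card_union_of_disjoint]
  · congr 1
    ext i
    rw [Finset.mem_union, Finset.mem_filter, Finset.mem_filter, Finset.mem_filter]
    simp only [Finset.mem_univ, true_and, Fin.ext_iff, Fin.val_one]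
    by_cases hi : (i : ℕ) < 2 * k
    · rw [ht i hi]
      omega
    · have : rowFn k i = 0 := by simp [rowFn, rowOf, hi]
      omega
  · rw [Finset.disjoint_left]
    intro i hi hi'
    rw [Finset.mem_filter] at hi hi'
    have : rowFn k i = 0 := by simp [rowFn, rowOf, hi'.2.1]
    omega

theorem highSet_nonempty (k : SpinIndex N) {m : ℕ} (hm : m ≤ N - 2 * k) :
    (highSet k m).Nonempty := by
  have hk := two_mul_le k
  -- Standard on the columns of length two, then 1 on the next m sites; the bound on m leaves room
  -- for them.
  let t : Fin N → Fin 2 := fun i =>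
    if (i : ℕ) < 2 * k then ⟨rowFn k i, Nat.lt_succ_of_le (rowOf_le _ _)⟩
    else if (i : ℕ) < 2 * k + m then 1 else 0
  have ht : ∀ i : Fin N, (i : ℕ) < 2 * k → (t i : ℕ) = rowFn k i := fun i hi => by
    simp [t, hi]
  refine ⟨t, mem_highSet.2 ⟨ht, ?_⟩⟩
  rw [weight_eq k ht]
  have : (Finset.univ.filter fun i : Fin N => 2 * (k : ℕ) ≤ i ∧ t i = 1) =
      Finset.univ.map ⟨fun j : Fin m => (⟨2 * k + j, by omega⟩ : Fin N),
        fun a b h => by simpa [Fin.ext_iff] using h⟩ := by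
    ext i
    rw [Finset.mem_filter, Finset.mem_map]
    constructor
    · rintro ⟨-, h1, h2⟩
      have h3 : (i : ℕ) < 2 * k + m := by
        by_contra hc
        simp [t, hc, not_lt.2 h1] at h2
      exact ⟨⟨i - 2 * k, by omega⟩, Finset.mem_univ _,
        Fin.ext (show 2 * (k : ℕ) + (i - 2 * k) = i by omega)⟩
    · rintro ⟨j, -, rfl⟩
      refine ⟨Finset.mem_univ _, Nat.le_add_right _ _, ?_⟩
      change t ⟨2 * k + j, _⟩ = 1
      simp [t]
  rw [this, Finset.card_map, Finset.card_univ, Fintype.card_fin]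

section Antisymmetric

variable {W : Type*} [AddCommGroup W] [Module ℂ W] {k : SpinIndex N} {g : SpinSpace N →ₗ[ℂ] W}

theorem apply_spinBasis_eq_zero
    (hg : ∀ τ ∈ colPerms k, ∀ x, g (sitePerm τ x) = csign τ • g x) {t : Fin N → Fin 2} {i : Fin N}
    (hi : (i : ℕ) < 2 * k) (ht : t (partner k i) = t i) : g (spinBasis t) = 0 := by
  have h := hg _ (swap_mem_colPerms (colOf_partner k i).symm) (spinBasis t)
  have ht' : t ∘ ⇑(Equiv.swap i (partner k i))⁻¹ = t := by
    ext1 j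
    rw [Equiv.swap_inv, Function.comp_apply, Equiv.swap_apply_def]
    split_ifs with h1 h2
    · rw [h1, ht]
    · rw [h2, ht]
    · rfl
  rw [sitePerm_spinBasis, ht', csign_swap (partner_ne hi).symm, neg_one_smul] at h
  have h2 : (2 : ℂ) • g (spinBasis t) = 0 := by
    rw [two_smul]
    nth_rewrite 1 [h]
    exact neg_add_cancel _
  exact (smul_eq_zero.1 h2).resolve_left two_ne_zero

/-- Antisymmetry reduces the polytabloid to its leading tabloid. A basis vector above that tabloid
which is not standard on some column of length two has both spins there equal to 1, so `g` kills it.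
-/
theorem apply_raise_polytabloid
    (hg : ∀ τ ∈ colPerms k, ∀ x, g (sitePerm τ x) = csign τ • g x) (m : ℕ) :
    g (raise (k + m) (polytabloid (stdTableau k))) =
      ((colPerms k).card : ℂ) • ∑ t ∈ highSet k m, g (spinBasis t) := by
  have h := map_colAntisymm (ρ := tabloidRep N) (k := k) (g := g ∘ₗ raise (k + m))
    (fun τ hτ v => by rw [LinearMap.comp_apply, raise_tabloidRep, hg τ hτ]; rfl)
    (Finsupp.single (rowFn k) 1)
  rw [← polytabloid_stdTableau, LinearMap.comp_apply, LinearMap.comp_apply, raise_single,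
    map_sum] at h
  rw [h]
  congr 1
  symm
  refine Finset.sum_subset (fun t ht => ?_) fun t ht ht' => ?_
  · rw [mem_highSet] at ht
    rw [Finset.mem_filter]
    refine ⟨Finset.mem_univ _, fun i => ?_, ht.2⟩
    by_cases hi : (i : ℕ) < 2 * k
    · rw [ht.1 i hi]
    · simp [rowFn, rowOf, hi]
  · rw [Finset.mem_filter] at ht
    rw [mem_highSet] at ht'
    push Not at ht'
    obtain ⟨i, hi, hne⟩ : ∃ i : Fin N, (i : ℕ) < 2 * k ∧ (t i : ℕ) ≠ rowFn k i := by
      by_contra! hc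
      exact ht' hc ht.2.2
    refine apply_spinBasis_eq_zero hg hi (Fin.ext ?_)
    have h1 := ht.2.1 i
    have h2 := ht.2.1 (partner k i)
    have h3 : rowFn k (partner k i) = 1 - rowFn k i := rowOf_partner hi
    have := (t i).2
    have := (t (partner k i)).2
    omega

end Antisymmetric

/-! ### The projection onto binary forms -/

/-- The factors of the binary form attached to a product state: the determinants of the columns
of length two and the linear forms of the columns of length one. -/
def formFactor (k : SpinIndex N) (s : Fin N → Fin 2 → ℂ) (i : Fin N) : MvPolynomial (Fin 2) ℂ :=
  if (i : ℕ) < 2 * k then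
    if (i : ℕ) % 2 = 0 then
      MvPolynomial.C (s i 0 * s (partner k i) 1 - s i 1 * s (partner k i) 0)
    else 1
  else MvPolynomial.C (s i 0) * MvPolynomial.X 0 + MvPolynomial.C (s i 1) * MvPolynomial.X 1

/-- The top entry of the column of `i`. -/
def colTop (k : SpinIndex N) (i : Fin N) : Fin N :=
  if (i : ℕ) < 2 * k ∧ (i : ℕ) % 2 = 1 then partner k i else i

/-- A factor involves only the spins of its own column, and the whole contribution of a column is
stored at its top entry. Changing spins in one column therefore changes a single factor. -/
theorem formFactor_congr {k : SpinIndex N} {s s' : Fin N → Fin 2 → ℂ} {i j : Fin N}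
    (h : ∀ l : Fin N, colOf k l ≠ colOf k i → s l = s' l) (hj : j ≠ colTop k i) :
    formFactor k s j = formFactor k s' j := by
  by_cases hlt : (j : ℕ) < 2 * k
  · by_cases he : (j : ℕ) % 2 = 0
    · have hc : colOf k j ≠ colOf k i := fun hc => by
        apply hj
        rcases eq_or_eq_partner hc with h1 | h1
        · subst h1
          simp [colTop, he]
        · have : (i : ℕ) < 2 * k := by rwa [h1, partner_lt] at hlt
          have h2 : (i : ℕ) % 2 = 1 := by
            rw [h1, partner_val, if_pos this] at he
            split_ifs at he <;> omega
          simp [colTop, this, h2, h1]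
      simp only [formFactor, h j hc, h (partner k j) (by rwa [colOf_partner])]
    · simp [formFactor, hlt, he]
  · have hc : colOf k j ≠ colOf k i := fun hc => by
      apply hj
      rcases eq_or_eq_partner hc with h1 | h1
      · subst h1
        simp [colTop, hlt]
      · have : ¬ (i : ℕ) < 2 * k := by rwa [h1, partner_lt] at hlt
        rw [h1, colTop, if_neg (by tauto)]
        ext
        simp [partner_val, this]
    simp only [formFactor, h j hc, if_neg hlt]

theorem prod_formFactor_eq {k : SpinIndex N} {s s' : Fin N → Fin 2 → ℂ} (i : Fin N)
    (h : ∀ l : Fin N, colOf k l ≠ colOf k i → s l = s' l) :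
    ∏ j, formFactor k s j =
      formFactor k s (colTop k i) * ∏ j ∈ Finset.univ.erase (colTop k i), formFactor k s' j := by
  rw [← Finset.mul_prod_erase _ _ (Finset.mem_univ (colTop k i))]
  congr 1
  exact Finset.prod_congr rfl fun j hj => formFactor_congr h (Finset.ne_of_mem_erase hj)

theorem prod_formFactor_update (k : SpinIndex N) (s : Fin N → Fin 2 → ℂ) (i : Fin N)
    (x : Fin 2 → ℂ) : ∏ j, formFactor k (Function.update s i x) j =
      formFactor k (Function.update s i x) (colTop k i) *
        ∏ j ∈ Finset.univ.erase (colTop k i), formFactor k s j :=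
  prod_formFactor_eq i fun l hl => by
    rw [Function.update_of_ne]
    rintro rfl
    exact hl rfl

theorem formFactor_colTop_update (k : SpinIndex N) (s : Fin N → Fin 2 → ℂ) (i : Fin N) :
    ∃ a b : MvPolynomial (Fin 2) ℂ, ∀ x : Fin 2 → ℂ,
      formFactor k (Function.update s i x) (colTop k i) =
        MvPolynomial.C (x 0) * a + MvPolynomial.C (x 1) * b := by
  by_cases hlt : (i : ℕ) < 2 * k
  · by_cases he : (i : ℕ) % 2 = 1
    · have h1 : colTop k i = partner k i := by simp [colTop, hlt, he]
      have h2 : (partner k i : ℕ) % 2 = 0 := by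
        rw [partner_val, if_pos hlt]
        split_ifs <;> omega
      refine ⟨-MvPolynomial.C (s (partner k i) 1), MvPolynomial.C (s (partner k i) 0),
        fun x => ?_⟩
      rw [h1, formFactor, if_pos (partner_lt.2 hlt), if_pos h2, partner_partner,
        Function.update_self, Function.update_of_ne (partner_ne hlt)]
      simp only [map_sub, map_mul]
      ring
    · have h1 : colTop k i = i := by simp [colTop, he]
      refine ⟨MvPolynomial.C (s (partner k i) 1), -MvPolynomial.C (s (partner k i) 0),
        fun x => ?_⟩
      rw [h1, formFactor, if_pos hlt, if_pos (by omega),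
        Function.update_self, Function.update_of_ne (partner_ne hlt)]
      simp only [map_sub, map_mul]
      ring
  · have h1 : colTop k i = i := by simp [colTop, hlt]
    refine ⟨MvPolynomial.X 0, MvPolynomial.X 1, fun x => ?_⟩
    rw [h1, formFactor, if_neg hlt, Function.update_self]

/-- The binary form attached to a product state, as a multilinear map. -/
def formMultilinear (k : SpinIndex N) :
    MultilinearMap ℂ (fun _ : Fin N => (Fin 2 → ℂ)) (MvPolynomial (Fin 2) ℂ) :=
  MultilinearMap.mk' (fun s => ∏ i, formFactor k s i)
    (fun s i x y => by
      obtain ⟨a, b, h⟩ := formFactor_colTop_update k s i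
      simp only [prod_formFactor_update, h, Pi.add_apply, map_add]
      ring)
    (fun s i c x => by
      obtain ⟨a, b, h⟩ := formFactor_colTop_update k s i
      simp only [prod_formFactor_update, h, Pi.smul_apply, smul_eq_mul, map_mul,
        MvPolynomial.smul_eq_C_mul]
      ring)

theorem formMultilinear_apply (k : SpinIndex N) (s : Fin N → Fin 2 → ℂ) :
    formMultilinear k s = ∏ i, formFactor k s i := rfl

theorem sum_ite_lt {a : ℕ} (ha : a ≤ N) :
    ∑ i : Fin N, (if (i : ℕ) < a then 0 else 1) = N - a := by
  obtain ⟨b, rfl⟩ := Nat.exists_eq_add_of_le ha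
  rw [Fin.sum_univ_add, Finset.sum_eq_zero fun i _ => if_pos i.2]
  simp

theorem isHomogeneous_formMultilinear (k : SpinIndex N) (s : Fin N → Fin 2 → ℂ) :
    (formMultilinear k s).IsHomogeneous (twiceSpin k) := by
  rw [twiceSpin, ← sum_ite_lt (two_mul_le k), formMultilinear_apply]
  refine MvPolynomial.IsHomogeneous.prod _ _ _ fun i _ => ?_
  rw [formFactor]
  split_ifs
  · exact MvPolynomial.isHomogeneous_C _ _
  · exact MvPolynomial.isHomogeneous_one _ _
  · refine MvPolynomial.IsHomogeneous.add ?_ ?_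
    · simpa using (MvPolynomial.isHomogeneous_C (Fin 2) (s i 0)).mul
        (MvPolynomial.isHomogeneous_X ℂ (0 : Fin 2))
    · simpa using (MvPolynomial.isHomogeneous_C (Fin 2) (s i 1)).mul
        (MvPolynomial.isHomogeneous_X ℂ (1 : Fin 2))

/-- The `SU(2)`-equivariant map from the spin space onto the binary forms of degree `2J`. -/
def toForm (k : SpinIndex N) : SpinSpace N →ₗ[ℂ] SpinIrrep (twiceSpin k) :=
  LinearMap.codRestrict _ (PiTensorProduct.lift (formMultilinear k)) fun x => by
    induction x using PiTensorProduct.induction_on with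
    | smul_tprod c s =>
      rw [map_smul, PiTensorProduct.lift.tprod]
      exact Submodule.smul_mem _ _ (isHomogeneous_formMultilinear k s)
    | add x y hx hy => rw [map_add]; exact add_mem hx hy

theorem toForm_tprod (k : SpinIndex N) (s : Fin N → Fin 2 → ℂ) :
    (toForm k (PiTensorProduct.tprod ℂ s) : MvPolynomial (Fin 2) ℂ) =
      ∏ i, formFactor k s i :=
  PiTensorProduct.lift.tprod s

/-- The determinants are multiplied by det U = 1, and the linear forms follow the substitution. -/
theorem polySubst_formFactor (k : SpinIndex N) (U : SU2) (s : Fin N → Fin 2 → ℂ) (i : Fin N) :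
    polySubst U (formFactor k s i) =
      formFactor k (fun i => (U : Matrix (Fin 2) (Fin 2) ℂ).mulVec (s i)) i := by
  have hdet : (U : Matrix (Fin 2) (Fin 2) ℂ) 0 0 * (U : Matrix (Fin 2) (Fin 2) ℂ) 1 1 -
      (U : Matrix (Fin 2) (Fin 2) ℂ) 0 1 * (U : Matrix (Fin 2) (Fin 2) ℂ) 1 0 = 1 := by
    rw [← Matrix.det_fin_two]
    exact (Matrix.mem_specialUnitaryGroup_iff.1 U.2).2
  rw [formFactor, formFactor]
  split_ifs
  · rw [polySubst, ← MvPolynomial.algebraMap_eq, AlgHom.commutes]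
    congr 1
    simp only [Matrix.mulVec, dotProduct, Fin.sum_univ_two]
    linear_combination (-(s i 0 * s (partner k i) 1 - s i 1 * s (partner k i) 0)) * hdet
  · rw [map_one]
  · simp only [polySubst, map_add, map_mul, MvPolynomial.aeval_X, Matrix.mulVec, dotProduct,
      Fin.sum_univ_two, MvPolynomial.smul_eq_C_mul, MvPolynomial.aeval_C,
      MvPolynomial.algebraMap_eq]
    ring

theorem toForm_collective (k : SpinIndex N) (U : SU2) (x : SpinSpace N) :
    toForm k (collective U x) = spinRep (twiceSpin k) U (toForm k x) := by
  refine LinearMap.congr_fun (f := toForm k ∘ₗ collective U)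
    (g := spinRep (twiceSpin k) U ∘ₗ toForm k) ?_ x
  refine PiTensorProduct.ext (MultilinearMap.ext fun s => Subtype.ext ?_)
  simp only [LinearMap.compMultilinearMap_apply, LinearMap.comp_apply, collective_tprod]
  rw [toForm_tprod]
  change _ = polySubst U (toForm k (PiTensorProduct.tprod ℂ s) : MvPolynomial (Fin 2) ℂ)
  rw [toForm_tprod, map_prod]
  exact Finset.prod_congr rfl fun i _ => (polySubst_formFactor k U s i).symm

theorem formFactor_colTop_swap {k : SpinIndex N} {i : Fin N} (hi : (i : ℕ) < 2 * k)
    (s : Fin N → Fin 2 → ℂ) :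
    formFactor k (fun j => s (Equiv.swap i (partner k i) j)) (colTop k i) =
      -formFactor k s (colTop k i) := by
  have hlt : (colTop k i : ℕ) < 2 * k := by
    rw [colTop]
    split_ifs
    · exact partner_lt.2 hi
    · exact hi
  have he : (colTop k i : ℕ) % 2 = 0 := by
    rw [colTop]
    split_ifs with h
    · rw [partner_val, if_pos hi]
      split_ifs <;> omega
    · omega
  rw [formFactor, formFactor, if_pos hlt, if_pos hlt, if_pos he, if_pos he, ← map_neg]
  congr 1
  rw [colTop]
  split_ifs
  · rw [partner_partner, Equiv.swap_apply_left, Equiv.swap_apply_right]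
    ring
  · rw [Equiv.swap_apply_left, Equiv.swap_apply_right]
    ring

/-- It suffices to treat the transposition of one column, which negates one determinant and leaves
the other factors alone. -/
theorem toForm_sitePerm {k : SpinIndex N} {τ : Equiv.Perm (Fin N)} (hτ : τ ∈ colPerms k) :
    ∀ x, toForm k (sitePerm τ x) = csign τ • toForm k x := by
  refine colPerms_induction (P := fun τ => ∀ x, toForm k (sitePerm τ x) = csign τ • toForm k x)
    (fun x => ?_) (fun i π hi hπ x => ?_) hτ
  · rw [sitePerm_one, csign_one, one_smul]
  · have hswap : toForm k ∘ₗ sitePerm (Equiv.swap i (partner k i)) = -toForm k := by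
      refine PiTensorProduct.ext (MultilinearMap.ext fun s => Subtype.ext ?_)
      simp only [LinearMap.compMultilinearMap_apply, LinearMap.comp_apply, sitePerm_tprod,
        Equiv.swap_inv, LinearMap.neg_apply]
      rw [toForm_tprod, Submodule.coe_neg, toForm_tprod,
        prod_formFactor_eq (s' := s) i, formFactor_colTop_swap hi,
        ← Finset.mul_prod_erase _ _ (Finset.mem_univ (colTop k i)), neg_mul]
      intro l hl
      rw [Equiv.swap_apply_of_ne_of_ne]
      · rintro rfl
        exact hl rfl
      · rintro rfl
        exact hl (colOf_partner k i)
    have := LinearMap.congr_fun hswap (sitePerm π x)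
    rw [LinearMap.comp_apply, LinearMap.neg_apply] at this
    rw [sitePerm_mul, this, hπ, csign_mul, csign_swap (partner_ne hi).symm, neg_one_mul]
    exact (neg_smul (csign π) (toForm k x)).symm

/-- The exponents of the monomial `X₀ⁿ⁻ᵐ X₁ᵐ`. -/
def formExp (n m : ℕ) : Fin 2 →₀ ℕ := Finsupp.single 0 (n - m) + Finsupp.single 1 m

/-- The monomial `X₀ⁿ⁻ᵐ X₁ᵐ`. -/
def formMonomial (n : ℕ) (m : Fin (n + 1)) : SpinIrrep n :=
  ⟨MvPolynomial.monomial (formExp n m) 1, MvPolynomial.isHomogeneous_monomial _ (by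
    have := m.2
    simp only [formExp, map_add, Finsupp.degree_single]
    omega)⟩

/-- On each column of length two the spins are (0, 1), with determinant 1. The remaining sites
contribute a variable each, and the weight says that exactly m of them contribute X₁. -/
theorem toForm_spinBasis {k : SpinIndex N} (m : Fin (twiceSpin k + 1)) {t : Fin N → Fin 2}
    (ht : t ∈ highSet k m) : toForm k (spinBasis t) = formMonomial _ m := by
  rw [mem_highSet] at ht
  apply Subtype.ext
  rw [spinBasis, toForm_tprod]
  have hw := weight_eq k ht.1
  rw [ht.2] at hw
  have h1 : ∀ i, formFactor k (fun i => Pi.single (t i) (1 : ℂ)) i =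
      MvPolynomial.monomial (if 2 * (k : ℕ) ≤ i then Finsupp.single (t i) 1 else 0) 1 := by
    intro i
    rw [formFactor]
    split_ifs with h2 h3 h4 h5 h6
    · omega
    · have h7 : (t i : ℕ) = 0 := by rw [ht.1 i h2]; simp [rowFn, rowOf, h2, h3]
      have h8 : (t (partner k i) : ℕ) = 1 := by
        rw [ht.1 _ (partner_lt.2 h2), rowFn, rowOf_partner h2]
        simp [rowOf, h2, h3]
      have h7 : t i = 0 := Fin.ext h7
      have h8 : t (partner k i) = 1 := Fin.ext h8
      simp [h7, h8]
    · omega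
    · rfl
    · rcases Fin.exists_fin_two.1 ⟨t i, rfl⟩ with h | h <;> rw [h] <;> simp [MvPolynomial.X]
    · omega
  rw [Finset.prod_congr rfl fun i _ => h1 i, ← MvPolynomial.monomial_sum_one]
  have hc : ∀ j : Fin 2,
      (∑ i : Fin N, if 2 * (k : ℕ) ≤ i then Finsupp.single (t i) 1 else 0 : Fin 2 →₀ ℕ) j =
        ∑ i : Fin N, if 2 * (k : ℕ) ≤ i ∧ t i = j then 1 else 0 := fun j => by
    rw [Finsupp.finsetSum_apply]
    refine Finset.sum_congr rfl fun i _ => ?_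
    by_cases h2 : 2 * (k : ℕ) ≤ i <;> simp [h2, Finsupp.single_apply]
  have h2 := sum_ite_lt (two_mul_le k)
  have h3 : ∑ i : Fin N, (if (i : ℕ) < 2 * k then 0 else 1) =
      (∑ i : Fin N, if 2 * (k : ℕ) ≤ i ∧ t i = 0 then 1 else 0) +
        ∑ i : Fin N, if 2 * (k : ℕ) ≤ i ∧ t i = 1 then 1 else 0 := by
    rw [← Finset.sum_add_distrib]
    refine Finset.sum_congr rfl fun i _ => ?_
    have := (t i).2
    simp only [Fin.ext_iff, Fin.val_zero, Fin.val_one]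
    split_ifs <;> omega
  rw [Finset.card_filter] at hw
  have hm : (m : ℕ) < N - 2 * k + 1 := m.2
  refine congrArg (fun d => MvPolynomial.monomial d 1) (Finsupp.ext fun j => ?_)
  have hn : twiceSpin k = N - 2 * k := rfl
  rw [hc]
  rcases Fin.exists_fin_two.1 ⟨j, rfl⟩ with h | h <;> rw [h] <;>
    simp only [formExp, Finsupp.add_apply, Finsupp.single_apply, zero_ne_one, one_ne_zero,
      if_true, if_false] <;> omega

theorem toForm_raise (k : SpinIndex N) (m : Fin (twiceSpin k + 1)) :
    ∃ a : ℂ, a ≠ 0 ∧ toForm k (raise (k + m) (polytabloid (stdTableau k))) =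
      a • formMonomial _ m := by
  -- Every element of `highSet` gives the same monomial with coefficient 1, so no cancellation can
  -- occur.
  refine ⟨(colPerms k).card * (highSet k m).card,
    mul_ne_zero (colPerms_card_ne_zero k) (Nat.cast_ne_zero.2
      (Finset.card_ne_zero.2 (highSet_nonempty k (Nat.le_of_lt_succ m.2)))), ?_⟩
  rw [apply_raise_polytabloid (fun τ hτ => toForm_sitePerm hτ), mul_smul,
    Finset.sum_congr rfl fun t ht => toForm_spinBasis m ht, Finset.sum_const,
    Nat.cast_smul_eq_nsmul ℂ (highSet k m).card]

/-! ### Generation of the spin space by the images of the polytabloids -/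

theorem exists_perm_pair {c d a b : Fin N} (hcd : c ≠ d) (hab : a ≠ b) :
    ∃ τ : Equiv.Perm (Fin N), τ c = a ∧ τ d = b ∧
      ∀ i, i ≠ a → i ≠ b → i ≠ c → i ≠ d → τ i = i := by
  -- The pairs may overlap, so the target of d is pulled back through the first swap.
  refine ⟨Equiv.swap c a * Equiv.swap d (Equiv.swap c a b), ?_, ?_, fun i ha hb hc hd => ?_⟩
  · rw [Equiv.Perm.mul_apply, Equiv.swap_apply_of_ne_of_ne hcd, Equiv.swap_apply_left]
    intro h
    rw [eq_comm, Equiv.swap_apply_eq_iff, Equiv.swap_apply_left] at h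
    exact hab h.symm
  · rw [Equiv.Perm.mul_apply, Equiv.swap_apply_left, Equiv.swap_apply_self]
  · rw [Equiv.Perm.mul_apply, Equiv.swap_apply_of_ne_of_ne hd, Equiv.swap_apply_of_ne_of_ne hc ha]
    intro h
    rw [eq_comm, Equiv.swap_apply_eq_iff, Equiv.swap_apply_of_ne_of_ne hc ha] at h
    exact hb h.symm

/-- Induction on the number of disagreements. Equal weights provide a site where only t is 1 and
another where only t' is 1; both are outside the columns of length two, and swapping them in t
removes both disagreements. -/
theorem apply_spinBasis_eq_of_mem_highSet {k : SpinIndex N} {φ : SpinSpace N →ₗ[ℂ] ℂ}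
    (hφ : ∀ a b : Fin N, 2 * (k : ℕ) ≤ a → 2 * (k : ℕ) ≤ b → a ≠ b →
      ∀ x, φ (sitePerm (Equiv.swap a b) x) = φ x)
    {m : ℕ} {t t' : Fin N → Fin 2} (ht : t ∈ highSet k m) (ht' : t' ∈ highSet k m) :
    φ (spinBasis t) = φ (spinBasis t') := by
  induction hn : (Finset.univ.filter fun i => t i ≠ t' i).card using Nat.strong_induction_on
    generalizing t with
  | _ n ih =>
    by_cases htt : t = t'
    · rw [htt]
    have hval : ∀ {j : Fin 2}, j ≠ 1 → j = 0 := by decide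
    have hne : (Finset.univ.filter fun i => t i = 1) ≠ Finset.univ.filter fun i => t' i = 1 := by
      intro h
      refine htt (funext fun i => ?_)
      have hi := Finset.ext_iff.1 h i
      rw [Finset.mem_filter, Finset.mem_filter] at hi
      by_cases h1 : t i = 1
      · rw [h1, (hi.1 ⟨Finset.mem_univ _, h1⟩).2]
      · rw [hval h1, hval fun h2 => h1 (hi.2 ⟨Finset.mem_univ _, h2⟩).2]
    have hcard : (Finset.univ.filter fun i => t i = 1).card =
        (Finset.univ.filter fun i => t' i = 1).card :=
      (mem_highSet.1 ht).2.trans (mem_highSet.1 ht').2.symm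
    obtain ⟨a, ha, ha'⟩ := Finset.not_subset.1 fun h =>
      hne (Finset.eq_of_subset_of_card_le h hcard.ge)
    obtain ⟨b, hb, hb'⟩ := Finset.not_subset.1 fun h =>
      hne (Finset.eq_of_subset_of_card_le h hcard.le).symm
    rw [Finset.mem_filter] at ha ha' hb hb'
    replace ha := ha.2
    replace hb := hb.2
    have ha' : t' a = 0 := hval fun h => ha' ⟨Finset.mem_univ _, h⟩
    have hb' : t b = 0 := hval fun h => hb' ⟨Finset.mem_univ _, h⟩
    have hab : a ≠ b := by
      rintro rfl
      rw [ha] at hb'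
      exact one_ne_zero hb'
    have hlow : ∀ i : Fin N, t i ≠ t' i → 2 * (k : ℕ) ≤ i := fun i hi => by
      by_contra hc
      exact hi (Fin.ext (((mem_highSet.1 ht).1 i (not_le.1 hc)).trans
        ((mem_highSet.1 ht').1 i (not_le.1 hc)).symm))
    have hka : 2 * (k : ℕ) ≤ a := hlow a (by rw [ha, ha']; exact one_ne_zero)
    have hkb : 2 * (k : ℕ) ≤ b := hlow b (by rw [hb, hb']; exact zero_ne_one)
    have hstep := hφ a b hka hkb hab (spinBasis t)
    rw [sitePerm_spinBasis, Equiv.swap_inv] at hstep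
    rw [← hstep]
    refine ih _ ?_ (t := t ∘ Equiv.swap a b) (mem_highSet.2 ⟨fun i hi => ?_, ?_⟩) rfl
    · rw [← hn]
      refine Finset.card_lt_card ((Finset.ssubset_iff_of_subset fun i hi => ?_).2 ⟨a, ?_, ?_⟩)
      · rw [Finset.mem_filter] at hi ⊢
        refine ⟨Finset.mem_univ _, fun h => hi.2 ?_⟩
        rw [Function.comp_apply, Equiv.swap_apply_def]
        split_ifs with h1 h2
        · rw [h1, hb', ha']
        · rw [h2, ha, hb]
        · exact h
      · rw [Finset.mem_filter, ha, ha']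
        exact ⟨Finset.mem_univ _, one_ne_zero⟩
      · rw [Finset.mem_filter, Function.comp_apply, Equiv.swap_apply_left, hb', ha']
        exact fun h => h.2 rfl
    · rw [Function.comp_apply, Equiv.swap_apply_of_ne_of_ne]
      · exact (mem_highSet.1 ht).1 i hi
      · rintro rfl
        omega
      · rintro rfl
        omega
    · exact (weight_comp t _).trans (mem_highSet.1 ht).2

theorem exists_mem_highSet (k : SpinIndex N) {t : Fin N → Fin 2}
    (ht : ∀ i : Fin N, (i : ℕ) < 2 * k → (t i : ℕ) = rowFn k i) :
    ∃ m ≤ N - 2 * k, t ∈ highSet k m := by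
  refine ⟨_, ?_, mem_highSet.2 ⟨ht, weight_eq k ht⟩⟩
  rw [← sum_ite_lt (two_mul_le k), Finset.card_filter]
  refine Finset.sum_le_sum fun i _ => ?_
  split_ifs <;> omega

/-- By symmetry φ is constant on each `highSet`, so `hzero` is a nonzero multiple of that constant.
Any other basis vector has a column with equal spins, where φ vanishes, or is a column permutation
away from a standard one. -/
theorem functional_eq_zero_of_symm {k : SpinIndex N} {φ : SpinSpace N →ₗ[ℂ] ℂ}
    (hanti : ∀ τ ∈ colPerms k, ∀ x, φ (sitePerm τ x) = csign τ • φ x)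
    (hsymm : ∀ a b : Fin N, 2 * (k : ℕ) ≤ a → 2 * (k : ℕ) ≤ b → a ≠ b →
      ∀ x, φ (sitePerm (Equiv.swap a b) x) = φ x)
    (hzero : ∀ m ≤ N - 2 * (k : ℕ), φ (raise (k + m) (polytabloid (stdTableau k))) = 0) :
    φ = 0 := by
  have hhigh : ∀ t : Fin N → Fin 2, (∀ i : Fin N, (i : ℕ) < 2 * k → (t i : ℕ) = rowFn k i) →
      φ (spinBasis t) = 0 := fun t ht => by
    obtain ⟨m, hm, htm⟩ := exists_mem_highSet k ht
    have h := hzero m hm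
    rw [apply_raise_polytabloid hanti, Finset.sum_congr rfl fun t' ht' =>
      apply_spinBasis_eq_of_mem_highSet hsymm ht' htm, Finset.sum_const] at h
    have h1 := (smul_eq_zero.1 h).resolve_left (colPerms_card_ne_zero k)
    exact (smul_eq_zero.1 h1).resolve_left (Finset.card_ne_zero_of_mem htm)
  refine spinBasis_hom_ext fun t => ?_
  rw [LinearMap.zero_apply]
  by_cases h : ∃ i : Fin N, (i : ℕ) < 2 * k ∧ t (partner k i) = t i
  · obtain ⟨i, hi, he⟩ := h
    exact apply_spinBasis_eq_zero hanti hi he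
  · push Not at h
    obtain ⟨π, hπ, hr⟩ := exists_colPerm_eq_rowOf k (fun i => (t i : ℕ))
      (fun i _ => Nat.le_of_lt_succ (t i).2) fun i hi he => h i hi (Fin.ext he)
    have h1 := hanti _ (inv_mem_colPerms hπ) (spinBasis t)
    rw [sitePerm_spinBasis, inv_inv, hhigh (t ∘ π) fun i hi => by
      have := hr i
      rwa [if_pos hi] at this] at h1
    refine (smul_eq_zero.1 h1.symm).resolve_left fun h2 => ?_
    have := csign_mul_self π⁻¹
    rw [h2, mul_zero] at this
    exact zero_ne_one this

theorem apply_sitePerm_of_swap {k : SpinIndex N} {φ : SpinSpace N →ₗ[ℂ] ℂ}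
    (h : ∀ i : Fin N, (i : ℕ) < 2 * k →
      ∀ x, φ (sitePerm (Equiv.swap i (partner k i)) x) = -φ x) :
    ∀ τ ∈ colPerms k, ∀ x, φ (sitePerm τ x) = csign τ • φ x := by
  refine fun τ hτ => colPerms_induction
    (P := fun τ => ∀ x, φ (sitePerm τ x) = csign τ • φ x) (fun x => ?_) (fun i π hi hπ x => ?_) hτ
  · rw [sitePerm_one, csign_one, one_smul]
  · rw [sitePerm_mul, h i hi, hπ, csign_mul, csign_swap (partner_ne hi).symm, neg_one_mul,
      neg_smul]

/-- Descending induction on k, with n = ⌊N/2⌋ - k. Symmetry in the remaining sites is not assumed: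
its failure for a pair a, b is a functional antisymmetric in that pair too, to which the case k + 1
applies. -/
theorem functional_eq_zero {R : Submodule ℂ (SpinSpace N)}
    (hR : ∀ σ, ∀ x ∈ R, sitePerm σ x ∈ R)
    (hmem : ∀ k : SpinIndex N, ∀ m ≤ N - 2 * (k : ℕ),
      raise (k + m) (polytabloid (stdTableau k)) ∈ R)
    (n : ℕ) (k : SpinIndex N) (hn : (k : ℕ) + n = N / 2) (φ : SpinSpace N →ₗ[ℂ] ℂ)
    (hφ : ∀ x ∈ R, φ x = 0)
    (hanti : ∀ i : Fin N, (i : ℕ) < 2 * k →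
      ∀ x, φ (sitePerm (Equiv.swap i (partner k i)) x) = -φ x) : φ = 0 := by
  induction n generalizing k φ with
  | zero =>
    refine functional_eq_zero_of_symm (apply_sitePerm_of_swap hanti) (fun a b ha hb hab => ?_)
      fun m hm => hφ _ (hmem k m hm)
    -- For k = ⌊N/2⌋ at most one site remains, so there is no pair to swap.
    have := a.2
    have := b.2
    have : (a : ℕ) ≠ b := fun h => hab (Fin.ext h)
    omega
  | succ n ih =>
    refine functional_eq_zero_of_symm (apply_sitePerm_of_swap hanti) (fun a b ha hb hab => ?_)
      fun m hm => hφ _ (hmem k m hm)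
    let k' : SpinIndex N := ⟨k + 1, by omega⟩
    have hk' : (k' : ℕ) = k + 1 := rfl
    let c : Fin N := ⟨2 * k, by omega⟩
    let d : Fin N := ⟨2 * k + 1, by omega⟩
    have hcd : c ≠ d := fun h => by simpa [c, d] using congrArg Fin.val h
    obtain ⟨τ, hc, hd, hτ⟩ := exists_perm_pair hcd hab
    -- Precomposing with τ moves the new antisymmetric pair a, b to the positions 2k, 2k+1 of the
    -- next column, while the earlier columns stay fixed.
    let ψ : SpinSpace N →ₗ[ℂ] ℂ := (φ - φ ∘ₗ sitePerm (Equiv.swap a b)) ∘ₗ sitePerm τ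
    have hψ : ∀ x, ψ x = φ (sitePerm τ x) - φ (sitePerm (Equiv.swap a b) (sitePerm τ x)) :=
      fun x => rfl
    have h0 : ψ = 0 := by
      refine ih k' (by omega) ψ (fun x hx => ?_) fun i hi x => ?_
      · rw [hψ, hφ _ (hR _ _ hx), hφ _ (hR _ _ (hR _ _ hx)), sub_zero]
      · by_cases hik : (i : ℕ) < 2 * k
        · have hp : partner k' i = partner k i := Fin.ext (by
            rw [partner_val, partner_val, if_pos hi, if_pos hik])
          have hfix : ∀ j : Fin N, (j : ℕ) < 2 * k → j ≠ a ∧ j ≠ b ∧ j ≠ c ∧ j ≠ d :=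
            fun j hj => by
              simp only [ne_eq, Fin.ext_iff, c, d]
              omega
          have hi1 := hfix i hik
          have hp1 := hfix (partner k i) (partner_lt.2 hik)
          rw [hp, hψ, hψ, ← sitePerm_mul τ, Equiv.mul_swap_eq_swap_mul,
            hτ i hi1.1 hi1.2.1 hi1.2.2.1 hi1.2.2.2, hτ _ hp1.1 hp1.2.1 hp1.2.2.1 hp1.2.2.2,
            sitePerm_mul _ τ, hanti i hik, ← sitePerm_mul (Equiv.swap a b),
            Equiv.mul_swap_eq_swap_mul, Equiv.swap_apply_of_ne_of_ne hi1.1 hi1.2.1,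
            Equiv.swap_apply_of_ne_of_ne hp1.1 hp1.2.1, sitePerm_mul _ (Equiv.swap a b),
            hanti i hik]
          ring
        · have hs : Equiv.swap i (partner k' i) = Equiv.swap c d := by
            have h1 := partner_val k' i
            rw [if_pos hi] at h1
            by_cases hic : (i : ℕ) = 2 * k
            · rw [if_pos (by omega)] at h1
              rw [show i = c from Fin.ext hic, show partner k' c = d from Fin.ext (by
                rw [← show i = c from Fin.ext hic, h1, hic])]
            · rw [if_neg (by omega)] at h1
              have hid : i = d := Fin.ext (show (i : ℕ) = 2 * k + 1 by omega)
              rw [show partner k' i = c from Fin.ext (show _ = 2 * (k : ℕ) by omega), hid,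
                Equiv.swap_comm]
          rw [hs, hψ, hψ, ← sitePerm_mul τ, Equiv.mul_swap_eq_swap_mul, hc, hd,
            sitePerm_mul _ τ, ← sitePerm_mul (Equiv.swap a b) (Equiv.swap a b),
            Equiv.swap_mul_self, sitePerm_one]
          ring
    intro x
    have h1 := hψ (sitePerm τ⁻¹ x)
    rw [h0, ← sitePerm_mul, mul_inv_cancel, sitePerm_one, LinearMap.zero_apply] at h1
    exact (sub_eq_zero.1 h1.symm).symm

/-- A proper subspace lies in the kernel of a nonzero functional. At k = 0 the antisymmetry
condition is empty. -/
theorem eq_top_of_raise_mem {R : Submodule ℂ (SpinSpace N)}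
    (hR : ∀ σ, ∀ x ∈ R, sitePerm σ x ∈ R)
    (hmem : ∀ k : SpinIndex N, ∀ m ≤ N - 2 * (k : ℕ),
      raise (k + m) (polytabloid (stdTableau k)) ∈ R) : R = ⊤ := by
  by_contra h
  obtain ⟨φ, hne, hle⟩ := Submodule.exists_le_ker_of_lt_top R (lt_top_iff_ne_top.2 h)
  exact hne (functional_eq_zero hR hmem (N / 2) 0 (by simp) φ (fun x hx => hle hx)
    fun i hi => absurd hi (by simp))

/-! ### The projections onto the sectors -/

/-- The projection `x ↦ ∑ σ, toForm (σ⁻¹ x) ⊗ σ e` onto the sector labelled by `k`. -/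
def toSector (k : SpinIndex N) : SpinSpace N →ₗ[ℂ] Sector N k :=
  ∑ σ : Equiv.Perm (Fin N), (TensorProduct.mk ℂ _ _).flip (spechtRep N (shape k) σ (stdPoly k)) ∘ₗ
    toForm k ∘ₗ sitePerm σ⁻¹

theorem toSector_apply (k : SpinIndex N) (x : SpinSpace N) : toSector k x =
    ∑ σ, toForm k (sitePerm σ⁻¹ x) ⊗ₜ spechtRep N (shape k) σ (stdPoly k) := by
  simp [toSector]

theorem sitePerm_collective (σ : Equiv.Perm (Fin N)) (U : SU2) (x : SpinSpace N) :
    sitePerm σ (collective U x) = collective U (sitePerm σ x) := by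
  refine LinearMap.congr_fun (f := sitePerm σ ∘ₗ collective U)
    (g := collective U ∘ₗ sitePerm σ) (PiTensorProduct.ext (MultilinearMap.ext fun s => ?_)) x
  simp only [LinearMap.compMultilinearMap_apply, LinearMap.comp_apply, collective_tprod,
    sitePerm_tprod]

theorem toSector_sitePerm (k : SpinIndex N) (τ : Equiv.Perm (Fin N)) (x : SpinSpace N) :
    toSector k (sitePerm τ x) =
      TensorProduct.map LinearMap.id (spechtRep N (shape k) τ) (toSector k x) := by
  rw [toSector_apply, toSector_apply, map_sum]
  refine Fintype.sum_equiv (Equiv.mulLeft τ⁻¹) _ _ fun σ => ?_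
  rw [TensorProduct.map_tmul, LinearMap.id_apply, Equiv.coe_mulLeft, ← spechtRep_mul,
    ← sitePerm_mul, mul_inv_cancel_left, mul_inv_rev, inv_inv]

theorem toSector_spinSpaceRep (k : SpinIndex N) (g : SU2 × Equiv.Perm (Fin N))
    (x : SpinSpace N) : toSector k (spinSpaceRep N g x) = sectorRep N k g (toSector k x) := by
  obtain ⟨U, τ⟩ := g
  have h1 : spinSpaceRep N (U, τ) x = sitePerm τ (collective U x) :=
    (sitePerm_collective τ U x).symm
  have h2 : ∀ p w, sectorRep N k (U, τ) (p ⊗ₜ w) =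
      spinRep (twiceSpin k) U p ⊗ₜ spechtRep N (shape k) τ w := fun _ _ => rfl
  rw [h1, toSector_sitePerm, toSector_apply, toSector_apply, map_sum, map_sum]
  refine Finset.sum_congr rfl fun σ _ => ?_
  rw [TensorProduct.map_tmul, LinearMap.id_apply, h2, sitePerm_collective, toForm_collective]

/-- The restriction of `raise` to a Specht module. -/
def raiseSpecht (k : SpinIndex N) (m : ℕ) : Specht N (shape k) →ₗ[ℂ] SpinSpace N :=
  raise (k + m) ∘ₗ (spechtSub N (shape k)).toSubmodule.subtype

theorem raiseSpecht_rep (k : SpinIndex N) (m : ℕ) (σ : Equiv.Perm (Fin N))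
    (w : Specht N (shape k)) :
    raiseSpecht k m (spechtRep N (shape k) σ w) = sitePerm σ (raiseSpecht k m w) :=
  raise_tabloidRep _ σ w

theorem toSector_raiseSpecht_of_ne {k l : SpinIndex N} (hkl : k ≠ l) (m : ℕ)
    (w : Specht N (shape k)) : toSector l (raiseSpecht k m w) = 0 := by
  classical
  exact hom_tensor_eq_zero (Module.Basis.ofVectorSpace ℂ (SpinIrrep (twiceSpin l)))
    (g := fun σ => spechtRep N (shape k) σ) (g' := fun σ => spechtRep N (shape l) σ)
    (specht_hom_eq_zero hkl) (toSector l ∘ₗ raiseSpecht k m)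
    (fun σ w => by
      rw [LinearMap.comp_apply, raiseSpecht_rep, toSector_sitePerm]
      rfl) w

/-- The sum `∑ σ, ⟨e, σ⁻¹ w⟩ σ e` over the translates of the standard polytabloid. -/
def spechtSum (k : SpinIndex N) : Specht N (shape k) →ₗ[ℂ] Specht N (shape k) :=
  ∑ σ, (stdCoeff k ∘ₗ colAntisymm (spechtRep N (shape k)) k ∘ₗ
    spechtRep N (shape k) σ⁻¹).smulRight (spechtRep N (shape k) σ (stdPoly k))

theorem spechtSum_apply (k : SpinIndex N) (w : Specht N (shape k)) : spechtSum k w =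
    ∑ σ, stdCoeff k (colAntisymm (spechtRep N (shape k)) k (spechtRep N (shape k) σ⁻¹ w)) •
      spechtRep N (shape k) σ (stdPoly k) := by
  simp [spechtSum]

theorem spechtSum_rep (k : SpinIndex N) (τ : Equiv.Perm (Fin N)) (w : Specht N (shape k)) :
    spechtSum k (spechtRep N (shape k) τ w) = spechtRep N (shape k) τ (spechtSum k w) := by
  rw [spechtSum_apply, spechtSum_apply, map_sum]
  refine Fintype.sum_equiv (Equiv.mulLeft τ⁻¹) _ _ fun σ => ?_
  rw [map_smul, Equiv.coe_mulLeft, ← spechtRep_mul, ← spechtRep_mul,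
    mul_inv_cancel_left, mul_inv_rev, inv_inv]

/-- Pairing with the polytabloid turns the sum into a sum of squared absolute values, and the term
of the identity is the square of the order of the column group. -/
theorem spechtSum_stdPoly_ne_zero (k : SpinIndex N) : spechtSum k (stdPoly k) ≠ 0 := by
  intro h0
  let e : (Fin N → ℕ) →₀ ℂ := polytabloid (stdTableau k)
  let a : Equiv.Perm (Fin N) → ℂ := fun σ =>
    colAntisymm (tabloidRep N) k (tabloidRep N σ⁻¹ e) (rowFn k)
  have h1 : tabloidPairing e (spechtSum k (stdPoly k) : Specht N (shape k)) =
      ∑ σ, ((Complex.normSq (a σ) : ℝ) : ℂ) := by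
    rw [← Submodule.subtype_apply, spechtSum_apply, map_sum, map_sum]
    refine Finset.sum_congr rfl fun σ _ => ?_
    rw [map_smul, map_smul, Submodule.subtype_apply, spechtRep_coe, smul_eq_mul]
    refine (congrArg _ (tabloidPairing_polytabloid k e σ)).trans ?_
    rw [← Complex.mul_conj]
    congr 1
    exact DFunLike.congr_fun (colAntisymm_coe k k (spechtRep N (shape k) σ⁻¹ (stdPoly k))) _
  rw [h0, Submodule.coe_zero, map_zero, ← Complex.ofReal_sum] at h1
  have h2 := (Finset.sum_eq_zero_iff_of_nonneg fun σ _ => Complex.normSq_nonneg (a σ)).1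
    (Complex.ofReal_eq_zero.1 h1.symm) 1 (Finset.mem_univ _)
  have h3 : a 1 = (colPerms k).card := by
    simp only [a, e]
    rw [inv_one, map_one, Module.End.one_apply, polytabloid_stdTableau, colAntisymm_colAntisymm,
      ← polytabloid_stdTableau, Finsupp.smul_apply, polytabloid_apply_rowFn, smul_eq_mul, mul_one]
  rw [Complex.normSq_eq_zero, h3] at h2
  exact colPerms_card_ne_zero k h2

/-- A sign-equivariant map sees w only through its antisymmetrization, which is a multiple of the
generator. -/
theorem toForm_raiseSpecht (k : SpinIndex N) (m : ℕ) (w : Specht N (shape k)) :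
    ((colPerms k).card : ℂ) • toForm k (raiseSpecht k m w) =
      stdCoeff k (colAntisymm (spechtRep N (shape k)) k w) •
        toForm k (raiseSpecht k m (stdPoly k)) := by
  rw [← LinearMap.comp_apply, ← map_colAntisymm (ρ := spechtRep N (shape k))
    (g := toForm k ∘ₗ raiseSpecht k m)]
  · obtain ⟨c, hc⟩ := colAntisymm_specht w
    rw [hc, map_smul, map_smul, stdCoeff_stdPoly, smul_eq_mul, mul_one]
    rfl
  · intro τ hτ v
    rw [LinearMap.comp_apply, raiseSpecht_rep, toForm_sitePerm hτ]
    rfl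

theorem exists_toSector_raiseSpecht (k : SpinIndex N) (m : Fin (twiceSpin k + 1)) :
    ∃ b : ℂ, b ≠ 0 ∧ ∀ w, toSector k (raiseSpecht k m w) = b • (formMonomial _ m ⊗ₜ w) := by
  obtain ⟨z, hz⟩ := specht_hom_eq_smul (spechtSum k) (spechtSum_rep k)
  obtain ⟨a, ha, ha'⟩ := toForm_raise k m
  have hz0 : z ≠ 0 := by
    rintro rfl
    exact spechtSum_stdPoly_ne_zero k (by rw [hz, zero_smul])
  have hC := colPerms_card_ne_zero k
  -- Here a comes from `toForm` on the raised generator, z is the scalar by which `spechtSum` acts,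
  -- and the order of the column group is the normalization in `toForm_raiseSpecht`.
  refine ⟨((colPerms k).card : ℂ)⁻¹ * (a * z), mul_ne_zero (inv_ne_zero hC)
    (mul_ne_zero ha hz0), fun w => ?_⟩
  rw [mul_smul, eq_inv_smul_iff₀ hC, toSector_apply, Finset.smul_sum, mul_smul,
    ← TensorProduct.tmul_smul, ← hz, spechtSum_apply, TensorProduct.tmul_sum, Finset.smul_sum]
  refine Finset.sum_congr rfl fun σ _ => ?_
  rw [← raiseSpecht_rep, TensorProduct.smul_tmul', toForm_raiseSpecht, TensorProduct.tmul_smul,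
    ← TensorProduct.smul_tmul', smul_comm a, TensorProduct.smul_tmul' a, ← ha']
  rfl

/-! ### The inverse of the decomposition -/

theorem coeff_formMonomial (n : ℕ) (m m' : Fin (n + 1)) :
    MvPolynomial.coeff (formExp n m) (formMonomial n m' : MvPolynomial (Fin 2) ℂ) =
      if m' = m then 1 else 0 := by
  change MvPolynomial.coeff _ (MvPolynomial.monomial (formExp n m') 1) = _
  rw [MvPolynomial.coeff_monomial]
  congr 1
  refine propext ⟨fun h => Fin.ext ?_, fun h => by rw [h]⟩
  simpa [formExp] using DFunLike.congr_fun h 1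

theorem sum_coeff_smul_formMonomial {n : ℕ} (p : SpinIrrep n) :
    ∑ m : Fin (n + 1), MvPolynomial.coeff (formExp n m) (p : MvPolynomial (Fin 2) ℂ) •
      formMonomial n m = p := by
  apply Subtype.ext
  rw [Submodule.coe_sum]
  ext d
  rw [MvPolynomial.coeff_sum]
  have h : ∀ m : Fin (n + 1), MvPolynomial.coeff d ((MvPolynomial.coeff (formExp n m)
      (p : MvPolynomial (Fin 2) ℂ) • formMonomial n m : SpinIrrep n) : MvPolynomial (Fin 2) ℂ) =
      if formExp n m = d then MvPolynomial.coeff d (p : MvPolynomial (Fin 2) ℂ) else 0 := by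
    intro m
    change MvPolynomial.coeff d (_ • MvPolynomial.monomial (formExp n m) 1) = _
    rw [MvPolynomial.coeff_smul, MvPolynomial.coeff_monomial]
    split_ifs with h
    · rw [h, smul_eq_mul, mul_one]
    · rw [smul_zero]
  rw [Finset.sum_congr rfl fun m _ => h m]
  by_cases hd : MvPolynomial.coeff d (p : MvPolynomial (Fin 2) ℂ) = 0
  · simp [hd]
  · have hdeg : d.degree = n := by
      by_contra hc
      exact hd (((MvPolynomial.mem_homogeneousSubmodule n _).1 p.2).coeff_eq_zero hc)
    rw [Finsupp.degree_eq_sum, Fin.sum_univ_two] at hdeg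
    -- An exponent of total degree n in two variables is determined by its second entry.
    have hdexp : formExp n (d 1) = d := by
      ext j
      rcases Fin.exists_fin_two.1 ⟨j, rfl⟩ with h | h <;> rw [h] <;>
        simp only [formExp, Finsupp.add_apply, Finsupp.single_apply, zero_ne_one, one_ne_zero,
          if_true, if_false] <;> omega
    rw [Finset.sum_eq_single (⟨d 1, by omega⟩ : Fin (n + 1))]
    · exact if_pos hdexp
    · intro m _ hm
      refine if_neg fun h => hm (Fin.ext ?_)
      simpa [formExp] using DFunLike.congr_fun h 1
    · exact fun h => absurd (Finset.mem_univ _) h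

/-- The coefficient of `X₀ⁿ⁻ᵐ X₁ᵐ`. -/
def formCoeff (n : ℕ) (m : Fin (n + 1)) : SpinIrrep n →ₗ[ℂ] ℂ :=
  MvPolynomial.lcoeff ℂ (formExp n m) ∘ₗ (spinSub n).toSubmodule.subtype

/-- The map `X₀ⁿ⁻ᵐ X₁ᵐ ⊗ w ↦ (b m)⁻¹ raiseSpecht w` from a sector to the spin space. -/
def ofSector (k : SpinIndex N) (b : Fin (twiceSpin k + 1) → ℂ) : Sector N k →ₗ[ℂ] SpinSpace N :=
  TensorProduct.lift (∑ m, ((b m)⁻¹ • formCoeff _ m).smulRight (raiseSpecht k m))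

theorem ofSector_tmul (k : SpinIndex N) (b : Fin (twiceSpin k + 1) → ℂ)
    (p : SpinIrrep (twiceSpin k)) (w : Specht N (shape k)) :
    ofSector k b (p ⊗ₜ w) = ∑ m, ((b m)⁻¹ * formCoeff _ m p) • raiseSpecht k m w := by
  simp [ofSector]

theorem ofSector_rep (k : SpinIndex N) (b : Fin (twiceSpin k + 1) → ℂ) (σ : Equiv.Perm (Fin N))
    (y : Sector N k) :
    ofSector k b (TensorProduct.map LinearMap.id (spechtRep N (shape k) σ) y) =
      sitePerm σ (ofSector k b y) := by
  refine LinearMap.congr_fun (f := ofSector k b ∘ₗ TensorProduct.map LinearMap.id _)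
    (g := sitePerm σ ∘ₗ ofSector k b) (TensorProduct.ext' fun p w => ?_) y
  simp only [LinearMap.comp_apply, TensorProduct.map_tmul, LinearMap.id_apply, ofSector_tmul,
    raiseSpecht_rep, map_sum, map_smul]

theorem ofSector_formMonomial {k : SpinIndex N} {b : Fin (twiceSpin k + 1) → ℂ}
    (hb : ∀ m, b m ≠ 0) (m : Fin (twiceSpin k + 1)) (w : Specht N (shape k)) :
    ofSector k b ((b m • formMonomial _ m) ⊗ₜ w) = raiseSpecht k m w := by
  have h : ∀ m', formCoeff _ m' (formMonomial (twiceSpin k) m) = if m = m' then 1 else 0 :=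
    fun m' => coeff_formMonomial _ m' m
  rw [ofSector_tmul, Finset.sum_eq_single m]
  · rw [map_smul, h, if_pos rfl, smul_eq_mul, mul_one, inv_mul_cancel₀ (hb m), one_smul]
  · intro m' _ hm
    rw [map_smul, h, if_neg hm.symm, smul_zero, mul_zero, zero_smul]
  · exact fun h => absurd (Finset.mem_univ _) h

theorem toSector_ofSector {k : SpinIndex N} {b : Fin (twiceSpin k + 1) → ℂ}
    (hb : ∀ m, b m ≠ 0)
    (h : ∀ (m : Fin (twiceSpin k + 1)) w,
      toSector k (raiseSpecht k m w) = b m • (formMonomial _ m ⊗ₜ w))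
    (y : Sector N k) : toSector k (ofSector k b y) = y := by
  refine LinearMap.congr_fun (f := toSector k ∘ₗ ofSector k b) (g := LinearMap.id)
    (TensorProduct.ext' fun p w => ?_) y
  rw [LinearMap.comp_apply, ofSector_tmul, map_sum, LinearMap.id_apply]
  conv_rhs => rw [← sum_coeff_smul_formMonomial p, TensorProduct.sum_tmul]
  refine Finset.sum_congr rfl fun m _ => ?_
  rw [map_smul, h, smul_smul, mul_right_comm, inv_mul_cancel₀ (hb m), one_mul,
    TensorProduct.smul_tmul']
  rfl

theorem toSector_ofSector_of_ne {k l : SpinIndex N} (hkl : k ≠ l)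
    (b : Fin (twiceSpin k + 1) → ℂ) (y : Sector N k) : toSector l (ofSector k b y) = 0 := by
  refine LinearMap.congr_fun (f := toSector l ∘ₗ ofSector k b) (g := 0)
    (TensorProduct.ext' fun p w => ?_) y
  rw [LinearMap.comp_apply, ofSector_tmul, map_sum]
  refine Finset.sum_eq_zero fun m _ => ?_
  rw [map_smul, toSector_raiseSpecht_of_ne hkl, smul_zero]

/-- The Schur-Weyl map from the spin space to the direct sum of the sectors. -/
def toSectors (N : ℕ) : SpinSpace N →ₗ[ℂ] ⨁ k : SpinIndex N, Sector N k :=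
  ∑ k, DirectSum.lof ℂ _ (Sector N) k ∘ₗ toSector k

theorem toSectors_apply (x : SpinSpace N) :
    toSectors N x = ∑ k, DirectSum.lof ℂ _ (Sector N) k (toSector k x) := by
  simp [toSectors]

/-- The right inverse `Ψ` is onto, because its range is stable under S_N and contains every raised
polytabloid. A surjective right inverse is two-sided. -/
theorem toSectors_bijective (N : ℕ) : Function.Bijective (toSectors N) := by
  choose b hb h using fun (k : SpinIndex N) m => exists_toSector_raiseSpecht k m
  let Ψ : (⨁ k : SpinIndex N, Sector N k) →ₗ[ℂ] SpinSpace N :=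
    DirectSum.toModule ℂ _ _ fun k => ofSector k (b k)
  have hlof : ∀ k y, Ψ (DirectSum.lof ℂ _ (Sector N) k y) = ofSector k (b k) y :=
    fun k y => DirectSum.toModule_lof ℂ k y
  have hright : ∀ y, toSectors N (Ψ y) = y := fun y => by
    refine LinearMap.congr_fun (f := toSectors N ∘ₗ Ψ) (g := LinearMap.id)
      (DirectSum.linearMap_ext ℂ fun k => LinearMap.ext fun z => ?_) y
    simp only [LinearMap.comp_apply, LinearMap.id_apply, hlof]
    rw [toSectors_apply, Finset.sum_eq_single k, toSector_ofSector (hb k) (h k)]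
    · intro l _ hl
      rw [toSector_ofSector_of_ne hl.symm, map_zero]
    · exact fun h => absurd (Finset.mem_univ _) h
  have htop : LinearMap.range Ψ = ⊤ := by
    refine eq_top_of_raise_mem (fun σ x hx => ?_) fun k m hm => ?_
    · obtain ⟨y, rfl⟩ := hx
      induction y using DirectSum.induction_on with
      | zero => rw [map_zero, map_zero]; exact zero_mem _
      | of k y =>
        refine ⟨DirectSum.lof ℂ _ (Sector N) k
          (TensorProduct.map LinearMap.id (spechtRep N (shape k) σ) y), ?_⟩
        rw [hlof, ofSector_rep, ← hlof]
        rfl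
      | add y z hy hz => rw [map_add, map_add]; exact add_mem hy hz
    · let m' : Fin (twiceSpin k + 1) := ⟨m, Nat.lt_succ_of_le hm⟩
      exact ⟨DirectSum.lof ℂ _ (Sector N) k ((b k m' • formMonomial _ m') ⊗ₜ stdPoly k),
        (hlof _ _).trans (ofSector_formMonomial (hb k) m' (stdPoly k))⟩
  refine ⟨(injective_iff_map_eq_zero _).2 fun x hx => ?_, fun y => ⟨Ψ y, hright y⟩⟩
  obtain ⟨y, rfl⟩ := LinearMap.range_eq_top.1 htop x
  rw [hright] at hx
  rw [hx, map_zero]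

theorem nonempty_decomposition (N : ℕ) : Nonempty (Decomposition N) := by
  refine ⟨Representation.Equiv.mk (LinearEquiv.ofBijective (toSectors N) (toSectors_bijective N))
    fun g => LinearMap.ext fun x => ?_⟩
  change toSectors N (spinSpaceRep N g x) =
    Representation.directSum (sectorRep N) g (toSectors N x)
  rw [toSectors_apply, toSectors_apply, map_sum]
  refine Finset.sum_congr rfl fun k _ => ?_
  rw [Representation.directSum_apply, DirectSum.lmap_lof, toSector_spinSpaceRep]

end SchurWeyl
end

theorem theorem1 (N : ℕ) :
    Nonempty (SchurWeyl.Decomposition N) ∧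
      ∀ (Φ : SchurWeyl.Decomposition N) (H : Module.End ℂ (SchurWeyl.SpinSpace N)),
        (∀ σ : Equiv.Perm (Fin N), Commute H (SchurWeyl.sitePerm σ)) →
          ∃ A : ∀ k : SchurWeyl.SpinIndex N,
              Module.End ℂ (SchurWeyl.SpinIrrep (SchurWeyl.twiceSpin k)),
            Φ.toLinearEquiv.toLinearMap ∘ₗ H ∘ₗ Φ.toLinearEquiv.symm.toLinearMap =
              SchurWeyl.blockDiagonal A :=
  ⟨SchurWeyl.nonempty_decomposition N, fun Φ _ hH => Φ.exists_blockDiagonal hH⟩
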